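/- **Setting.** Let $M$ be a finite-dimensional smooth manifold without boundary (Hausdorff, second countable) with a compatible distance (for example a Riemannian one) and its class of Lebesgue-null sets, let $X$ be a connected compact metric space, and let $(f_t)_{t\in X}$ be a family of $C^1$ diffeomorphisms of $M$ (in particular, $C^{1+\alpha}$ diffeomorphisms are allowed) such that $(t,x)\mapsto f_t(x)$ is continuous. Fix $t_0\in X$, write $f_0:=f_{t_0}$, and let $U\subset M$ be open. Let $(\theta_\varepsilon)_{\varepsilon>0}$ be Borel probability measures on $X$ whose supports have non-empty interior and satisfy $\operatorname{supp}\theta_\varepsilon\to\{t_0\}$ as $\varepsilon\to0^+$. Assume that $(\hat f,\theta_\varepsilon)_{\varepsilon>0}$ is a non-degenerate random perturbation of $f_0$ on $U$: for every small enough $\varepsilon>0$ there is $\delta>0$ such that for all $x\in U$ the set $\{f_t(x):t\in\operatorname{supp}\theta_\varepsilon\}$ contains the ball of radius $\delta$ around $f_0(x)$, and the image of $\theta_\varepsilon$ under $t\mapsto f_t(x)$ is absolutely continuous with respect to Lebesgue measure. **Definitions.** For $\omega\in X^{\mathbb N}$ or $\omega\in X^{\mathbb Z}$ put $f^n_\omega=f_{\omega_{n-1}}\circ\dots\circ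 f_{\omega_0}$ for $n\ge 0$, and for $\omega\in X^{\mathbb Z}$ and $n\ge1$ put $f^{-n}_\omega=f_{\omega_{-n}}^{-1}\circ\dots\circ f_{\omega_{-1}}^{-1}$. A probability measure $\mu$ on $M$ is stationary for $\theta_\varepsilon$ if $\int\!\int\varphi(f_t(x))\,d\mu(x)\,d\theta_\varepsilon(t)=\int\varphi\,d\mu$ for all bounded continuous $\varphi:M\to\mathbb R$. For a finite measurable partition $\eta$ let $H_\mu(\eta)=-\sum_{A\in\eta}\mu(A)\log\mu(A)$, $$h_\mu((\hat f,\theta_\varepsilon),\eta)=\inf_{n\ge1}\frac1n\int H_\mu\Big(\bigvee_{i=0}^{n-1}(f^i_\omega)^{-1}\eta\Big)\,d\theta_\varepsilon^{\mathbb N}(\omega),\qquad h_\mu(\hat f,\theta_\varepsilon)=\sup_\eta h_\mu((\hat f,\theta_\varepsilon),\eta),$$ the supremum being over all finite measurable partitions of $M$, and $h_\mu(f_0,\eta)=\inf_{n\ge1}\frac1nH_\mu\big(\bigvee_{i=0}^{n-1}f_0^{-i}\eta\big)$. A finite family $\xi$ of Borel sets is a partition of $M$ Lebesgue modulo zero if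 the intersection of any two distinct members and the complement of the union are Lebesgue-null. It is a random generating partition (Lebesgue modulo zero) for $\varepsilon$ if there is a Lebesgue-null Borel set $N\subset M$ such that for $\theta_\varepsilon^{\mathbb Z}$-almost every $\omega\in X^{\mathbb Z}$ every Borel set $A\subset M$ satisfies $A\setminus N=B\setminus N$ for some $B$ in the $\sigma$-algebra generated by the sets $(f^i_\omega)^{-1}(C)$, $C\in\xi$, $i\in\mathbb Z$. **Theorem.** Suppose that a finite partition $\xi$ of $M$ (Lebesgue modulo zero) is a random generating partition (Lebesgue modulo zero) for every small enough $\varepsilon>0$. Let $\varepsilon_j>0$, $\varepsilon_j\to0$, let $\mu^{\varepsilon_j}$ be probability measures on $M$ with $\mu^{\varepsilon_j}(U)=1$ that are stationary for $\theta_{\varepsilon_j}$, and suppose $\mu^{\varepsilon_j}\to\mu^0$ weakly$^*$ for a probability measure $\mu^0$ on $M$. Assume that $\mu^0(\partial C)=0$ for every $C\in\xi$. Then $$\limsup_{j\to\infty}h_{\mu^{\varepsilon_j}}(\hat f,\theta_{\varepsilon_j})\le h_{\mu^0}(f_0,\xi).$$ -/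

import Mathlib

open MeasureTheory Filter Topology Set
open scoped ENNReal Manifold ContDiff BoundedContinuousFunction

namespace RandomDyn

noncomputable section

/-! ### Lebesgue-null subsets of a manifold -/

/-- `A` is a Lebesgue-null subset of the `d`-dimensional manifold `M`: it is read as a
Lebesgue-null subset of `ℝ^d` in every chart of the atlas. -/
def IsLebesgueNull (d : ℕ) {M : Type*} [TopologicalSpace M]
    [ChartedSpace (EuclideanSpace ℝ (Fin d)) M] (A : Set M) : Prop :=
  ∀ φ ∈ atlas (EuclideanSpace ℝ (Fin d)) M,
    (volume : Measure (EuclideanSpace ℝ (Fin d))) (φ '' (A ∩ φ.source)) = 0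

/-- The Borel measure `ν` is absolutely continuous with respect to Lebesgue measure. -/
def LebesgueAC (d : ℕ) {M : Type*} [TopologicalSpace M]
    [ChartedSpace (EuclideanSpace ℝ (Fin d)) M] [MeasurableSpace M] (ν : Measure M) : Prop :=
  ∀ A : Set M, MeasurableSet A → IsLebesgueNull d A → ν A = 0

/-! ### Finite partitions -/

/-- A finite measurable partition of `M` (empty atoms are allowed). -/
structure IsPartition {M : Type*} [MeasurableSpace M] {k : ℕ} (η : Fin k → Set M) : Prop where
  measurableSet : ∀ i, MeasurableSet (η i)
  disjoint : ∀ i j, i ≠ j → Disjoint (η i) (η j)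
  iUnion_eq : ⋃ i, η i = univ

/-- A finite Borel partition of `M` modulo Lebesgue-null sets. -/
structure IsLebesguePartition (d : ℕ) {M : Type*} [TopologicalSpace M]
    [ChartedSpace (EuclideanSpace ℝ (Fin d)) M] [MeasurableSpace M] {k : ℕ}
    (ξ : Fin k → Set M) : Prop where
  measurableSet : ∀ i, MeasurableSet (ξ i)
  null_inter : ∀ i j, i ≠ j → IsLebesgueNull d (ξ i ∩ ξ j)
  null_compl : IsLebesgueNull d (⋃ i, ξ i)ᶜ

/-- `H_μ(P) = - ∑ᵢ μ(Pᵢ) log μ(Pᵢ)`. -/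
def partitionEntropy {M : Type*} [MeasurableSpace M] {ι : Type*} [Fintype ι]
    (μ : Measure M) (P : ι → Set M) : ℝ :=
  ∑ i, Real.negMulLog (μ.real (P i))

/-! ### Entropy of a single map -/

/-- The atoms of `⋁_{i < n} g^{-i} η`, indexed by itineraries of length `n`. -/
def iterJoin {M : Type*} {k : ℕ} (g : M → M) (η : Fin k → Set M) (n : ℕ) :
    (Fin n → Fin k) → Set M :=
  fun a => {x | ∀ i : Fin n, g^[(i : ℕ)] x ∈ η (a i)}

/-- The metric entropy `h_μ(g, η) = inf_{n ≥ 1} (1/n) H_μ(⋁_{i < n} g^{-i} η)` of `g` with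
respect to `η`; for `g`-invariant `μ` the infimum is also the limit. -/
def mapEntropy {M : Type*} [MeasurableSpace M] {k : ℕ} (g : M → M) (μ : Measure M)
    (η : Fin k → Set M) : ℝ≥0∞ :=
  ⨅ n : ℕ+, ENNReal.ofReal (partitionEntropy μ (iterJoin g η n)) / ((n : ℕ) : ℝ≥0∞)

/-! ### Random compositions -/

/-- `f^n_w = f_{w_{n-1}} ∘ ⋯ ∘ f_{w_0}` for a one-sided sequence `w`. -/
def fwd {X M : Type*} (f : X → M ≃ M) (w : ℕ → X) : ℕ → M → M
  | 0, x => x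
  | n + 1, x => f (w n) (fwd f w n x)

/-- `f^{-n}_w = f_{w_{-n}}⁻¹ ∘ ⋯ ∘ f_{w_{-1}}⁻¹` for a two-sided sequence `w`. -/
def bwd {X M : Type*} (f : X → M ≃ M) (w : ℤ → X) : ℕ → M → M
  | 0, x => x
  | n + 1, x => (f (w (-((n : ℤ) + 1)))).symm (bwd f w n x)

/-- `f^n_w` for a two-sided sequence `w` and `n ∈ ℤ`. -/
def orbitMap {X M : Type*} (f : X → M ≃ M) (w : ℤ → X) : ℤ → M → M
  | Int.ofNat n => fwd f (fun i => w i) n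
  | Int.negSucc n => bwd f w (n + 1)

/-- The atoms of `⋁_{i < n} (f^i_w)⁻¹ η`, indexed by itineraries of length `n`. -/
def randomJoin {X M : Type*} {k : ℕ} (f : X → M ≃ M) (w : ℕ → X) (η : Fin k → Set M) (n : ℕ) :
    (Fin n → Fin k) → Set M :=
  fun a => {x | ∀ i : Fin n, fwd f w i x ∈ η (a i)}

/-- The entropy of the random system `(f, θ)` with respect to the partition `η`:
`h_μ((f, θ), η) = inf_{n ≥ 1} (1/n) ∫ H_μ(⋁_{i < n} (f^i_w)⁻¹ η) dθ^ℕ(w)`. -/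
def randomEntropyWrt {X M : Type*} [MeasurableSpace X] [MeasurableSpace M] {k : ℕ}
    (f : X → M ≃ M) (θ : Measure X) (μ : Measure M) (η : Fin k → Set M) : ℝ≥0∞ :=
  ⨅ n : ℕ+, (∫⁻ w, ENNReal.ofReal (partitionEntropy μ (randomJoin f w η n))
    ∂(Measure.infinitePi fun _ : ℕ => θ)) / ((n : ℕ) : ℝ≥0∞)

/-- The metric entropy `h_μ(f, θ)` of the random system: the supremum of `h_μ((f, θ), η)` over
all finite measurable partitions `η`. -/
def randomEntropy {X M : Type*} [MeasurableSpace X] [MeasurableSpace M]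
    (f : X → M ≃ M) (θ : Measure X) (μ : Measure M) : ℝ≥0∞ :=
  ⨆ (k : ℕ) (η : Fin k → Set M) (_ : IsPartition η), randomEntropyWrt f θ μ η

/-- `μ` is stationary for `(f, θ)`: `∫∫ φ(f_t(x)) dμ(x) dθ(t) = ∫ φ dμ` for all (bounded)
continuous `φ`. -/
def IsStationary {X M : Type*} [MeasurableSpace X] [TopologicalSpace M] [MeasurableSpace M]
    (f : X → M ≃ M) (θ : Measure X) (μ : Measure M) : Prop :=
  ∀ φ : M →ᵇ ℝ, ∫ t, ∫ x, φ (f t x) ∂μ ∂θ = ∫ x, φ x ∂μ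

/-- `(f, θ_ε)_{ε > 0}` is a non-degenerate random perturbation of `f_{t₀}` on `U`. -/
structure IsNondegenerate (d : ℕ) {X M : Type*} [TopologicalSpace X] [MeasurableSpace X]
    [MetricSpace M] [ChartedSpace (EuclideanSpace ℝ (Fin d)) M] [MeasurableSpace M]
    (f : X → M ≃ M) (θ : ℝ → Measure X) (t₀ : X) (U : Set M) : Prop where
  /-- the supports have non-empty interior -/
  interior_support : ∀ ε : ℝ, 0 < ε → (interior (θ ε).support).Nonempty
  /-- the supports shrink to `{t₀}` -/
  support_tendsto : ∀ V ∈ 𝓝 t₀, ∀ᶠ ε in 𝓝[>] (0 : ℝ), (θ ε).support ⊆ V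
  /-- for small `ε` the random images of `x` cover a ball around `f_{t₀}(x)` of radius
  independent of `x`, and are distributed absolutely continuously -/
  nondegenerate : ∀ᶠ ε in 𝓝[>] (0 : ℝ), ∃ δ : ℝ, 0 < δ ∧ ∀ x ∈ U,
    Metric.ball (f t₀ x) δ ⊆ (fun t => f t x) '' (θ ε).support ∧
    LebesgueAC d ((θ ε).map fun t => f t x)

/-- The σ-algebra `⋁_{n ∈ ℤ} (f^n_w)⁻¹ ξ`. -/
abbrev orbitSigma {X M : Type*} {k : ℕ} (f : X → M ≃ M) (w : ℤ → X) (ξ : Fin k → Set M) :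
    MeasurableSpace M :=
  MeasurableSpace.generateFrom {B | ∃ (n : ℤ) (i : Fin k), B = orbitMap f w n ⁻¹' ξ i}

/-- `ξ` is a random generating partition for `(f, θ)`, Lebesgue modulo zero: outside a
Lebesgue-null set `N ⊆ M` (not depending on `w`), the σ-algebra `⋁_{n ∈ ℤ} (f^n_w)⁻¹ ξ` has the
same traces as the Borel σ-algebra, for `θ^ℤ`-almost every `w`. -/
def IsRandomGenerating (d : ℕ) {X M : Type*} [MeasurableSpace X] [TopologicalSpace M]
    [ChartedSpace (EuclideanSpace ℝ (Fin d)) M] [MeasurableSpace M] {k : ℕ}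
    (f : X → M ≃ M) (θ : Measure X) (ξ : Fin k → Set M) : Prop :=
  ∃ N : Set M, MeasurableSet N ∧ IsLebesgueNull d N ∧
    ∀ᵐ w ∂(Measure.infinitePi fun _ : ℤ => θ), ∀ A : Set M, MeasurableSet A →
      ∃ B : Set M, MeasurableSet[orbitSigma f w ξ] B ∧ A \ N = B \ N

end

end RandomDyn

namespace RandomDyn

/-! ### Locally compact second countable metric spaces are standard Borel -/

/-! For each `N`, the random entropy is bounded by an annealed quantity that passes to the zero
noise limit: the entropy of the `ξ`-itinerary of length `N` under `θ^ℕ × μ`, divided by `N`. Here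
the noise is averaged before entropy is taken, whereas `randomEntropy` averages afterwards.

The bound (`randomEntropy_le_of_generating`) rests on two facts. First, `exists_guess`: since `ξ`
generates, the label of a point with respect to any other finite partition `η` is predicted, with
small error, by the noise and the `ξ`-labels in a finite window of its two-sided orbit. This needs a
measure on `X^ℤ × M` in which the present point depends on the past noise
(`exists_naturalExtension`), and injectivity of the itinerary map on a set of full measure. Second,
`lintegral_entropy_le`: by Gibbs' inequality the entropy of a long `η`-word is at most the mean cost
of any code for it. The code used here describes the `ξ`-word in blocks of length `N` by their
annealed probabilities, then corrects the predicted `η`-letters. The corrections and the ends of the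
word cost arbitrarily little per letter.

As `ε → 0` the measures `θ_ε^ℕ × μ^ε` converge weakly to `δ_{t₀}^ℕ × μ⁰`. Itinerary cylinders have
null boundary for the limit, because `μ⁰` is `f_{t₀}`-invariant and `μ⁰(∂C) = 0`, so their
probabilities converge (`tendsto_itinerary`). The infimum over `N` ends the proof. Non-degeneracy
enters through `measure_eq_zero_of_isLebesgueNull`: Lebesgue-null exceptional sets are null for
stationary measures. -/

theorem standardBorelSpace_of_measurableEquiv {α β : Type*} [MeasurableSpace α]
    [MeasurableSpace β] [h : StandardBorelSpace β] (e : α ≃ᵐ β) : StandardBorelSpace α := by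
  obtain ⟨tβ, hβ, hp⟩ := h.polish
  let : TopologicalSpace α := tβ.induced e
  refine ⟨⟨tβ.induced e, ⟨?_⟩, e.toEquiv.polishSpace_induced⟩⟩
  have h1 : borel α = (borel β).comap e := borel_comap
  rw [h1, ← hβ.measurable_eq, e.measurableEmbedding.comap_eq]

/-- The given metric need not be complete, but a σ-compact space is a countable union of compact
sets in its Polish completion, hence Borel there. The Lusin–Souslin theorem then becomes available
on `M`. -/
theorem standardBorelSpace_of_sigmaCompact (M : Type*) [MetricSpace M] [SigmaCompactSpace M]
    [SecondCountableTopology M] [MeasurableSpace M] [BorelSpace M] : StandardBorelSpace M := by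
  borelize (UniformSpace.Completion M)
  have hr : MeasurableSet (range ((↑) : M → UniformSpace.Completion M)) := by
    rw [← image_univ, ← iUnion_compactCovering, image_iUnion]
    exact .iUnion fun n => ((isCompact_compactCovering M n).image
      (UniformSpace.Completion.continuous_coe M)).measurableSet
  have he : MeasurableEmbedding ((↑) : M → UniformSpace.Completion M) :=
    (UniformSpace.Completion.isUniformEmbedding_coe M).isEmbedding.measurableEmbedding hr
  have : StandardBorelSpace (range ((↑) : M → UniformSpace.Completion M)) := hr.standardBorel
  exact standardBorelSpace_of_measurableEquiv he.equivRange

/-! ### Random compositions -/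

section Maps

variable {X M : Type*} (f : X → M ≃ M)

/-- The skew product `(w, x) ↦ (σ w, f_{w₀} x)` over the one-sided shift. -/
def skew (p : (ℕ → X) × M) : (ℕ → X) × M := (fun i => p.1 (i + 1), f (p.1 0) p.2)

theorem fwd_succ' (w : ℕ → X) (n : ℕ) (x : M) :
    fwd f w (n + 1) x = fwd f (fun i => w (i + 1)) n (f (w 0) x) := by
  induction n with
  | zero => rfl
  | succ n ih => rw [fwd, ih]; rfl

theorem skew_iterate (n : ℕ) (p : (ℕ → X) × M) :
    (skew f)^[n] p = (fun i => p.1 (i + n), fwd f p.1 n p.2) := by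
  induction n generalizing p with
  | zero => rfl
  | succ n ih =>
    rw [Function.iterate_succ_apply, ih, skew]
    simp only [fwd_succ']
    congr 1

theorem fwd_add (w : ℕ → X) (n r : ℕ) (x : M) :
    fwd f w (n + r) x = fwd f (fun i => w (i + n)) r (fwd f w n x) := by
  have h := congrArg Prod.snd (Function.iterate_add_apply (skew f) r n (w, x))
  simpa only [skew_iterate, add_comm r n] using h

theorem fwd_const (t : X) (n : ℕ) (x : M) : fwd f (fun _ => t) n x = (f t)^[n] x := by
  induction n with
  | zero => rfl
  | succ n ih => rw [fwd, ih, Function.iterate_succ_apply']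

theorem bwd_congr {w w' : ℤ → X} (n : ℕ) (h : ∀ i < n, w (-((i : ℤ) + 1)) = w' (-((i : ℤ) + 1)))
    (x : M) : bwd f w n x = bwd f w' n x := by
  induction n with
  | zero => rfl
  | succ n ih => rw [bwd, bwd, ih fun i hi => h i (by omega), h n (by omega)]

theorem orbitMap_add_one (w : ℤ → X) (z : ℤ) (x : M) :
    orbitMap f w (z + 1) x = f (w z) (orbitMap f w z x) := by
  match z with
  | Int.ofNat n => rfl
  | Int.negSucc 0 => simp [orbitMap, bwd, fwd]
  | Int.negSucc (n + 1) =>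
    have h : Int.negSucc (n + 1) + 1 = Int.negSucc n := by omega
    have h2 : Int.negSucc (n + 1) = -(((n + 1 : ℕ) : ℤ) + 1) := by omega
    have h3 : bwd f w (n + 1 + 1) x = (f (w (-(((n + 1 : ℕ) : ℤ) + 1)))).symm (bwd f w (n + 1) x) :=
      rfl
    rw [h, orbitMap, orbitMap, h3, ← h2, Equiv.apply_symm_apply]

theorem orbitMap_neg (w : ℤ → X) (m : ℕ) (x : M) : orbitMap f w (-(m : ℤ)) x = bwd f w m x := by
  cases m with
  | zero => rfl
  | succ m => rfl

theorem fwd_bwd (w : ℤ → X) (m n : ℕ) (x : M) :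
    fwd f (fun i => w (i - m)) n (bwd f w m x) = orbitMap f w (n - m) x := by
  induction n with
  | zero => simp [orbitMap_neg, fwd]
  | succ n ih =>
    rw [fwd, ih, ← orbitMap_add_one]
    congr 1
    push_cast
    ring

theorem bwd_fwd (w : ℤ → X) (m : ℕ) (x : M) :
    bwd f w m (fwd f (fun i => w (i - m)) m x) = x := by
  induction m generalizing x with
  | zero => rfl
  | succ m ih =>
    rw [bwd, fwd_succ']
    have h := ih (f (w (((0 : ℕ) : ℤ) - ((m + 1 : ℕ) : ℤ))) x)
    have e : (fun i : ℕ => w (((i + 1 : ℕ) : ℤ) - ((m + 1 : ℕ) : ℤ))) = fun i : ℕ => w (i - m) := by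
      funext i
      congr 1
      push_cast
      ring
    rw [e, h]
    have e2 : (((0 : ℕ) : ℤ) - ((m + 1 : ℕ) : ℤ)) = -((m : ℤ) + 1) := by push_cast; ring
    rw [e2, Equiv.symm_apply_apply]

/-- The orbit of `x` read from time `-m` on. -/
def pastShift (m : ℕ) (p : (ℤ → X) × M) : (ℕ → X) × M :=
  (fun i => p.1 (i - m), bwd f p.1 m p.2)

end Maps

section MeasurableMaps

variable {X M : Type*} [MeasurableSpace X] [MeasurableSpace M] {f : X → M ≃ M}

theorem measurable_fwd (hf : Measurable fun p : X × M => f p.1 p.2) (n : ℕ) :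
    Measurable fun p : (ℕ → X) × M => fwd f p.1 n p.2 := by
  induction n with
  | zero => exact measurable_snd
  | succ n ih =>
    exact hf.comp (((measurable_pi_apply n).comp measurable_fst).prodMk ih)

/-- Only the forward maps are assumed jointly continuous. The map `(t, x) ↦ (t, f_t x)` is injective
and measurable, so by Lusin–Souslin its images of Borel sets are Borel, which is measurability of
its inverse. -/
theorem measurable_symm [StandardBorelSpace X] [StandardBorelSpace M]
    (hf : Measurable fun p : X × M => f p.1 p.2) :
    Measurable fun p : X × M => (f p.1).symm p.2 := by
  have hm : Measurable fun p : X × M => (p.1, f p.1 p.2) := measurable_fst.prodMk hf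
  have hi : Function.Injective fun p : X × M => (p.1, f p.1 p.2) := by
    rintro ⟨a, b⟩ ⟨a', b'⟩ h
    simp only [Prod.mk.injEq] at h
    obtain ⟨rfl, h⟩ := h
    rw [(f a).injective h]
  have he := hm.measurableEmbedding hi
  have : Measurable fun p : X × M => (p.1, (f p.1).symm p.2) := by
    intro s hs
    convert he.measurableSet_image' hs using 1
    ext ⟨a, b⟩
    constructor
    · intro h
      exact ⟨_, h, by simp⟩
    · rintro ⟨⟨a', b'⟩, h, h'⟩
      simp only [Prod.mk.injEq] at h'
      obtain ⟨rfl, rfl⟩ := h'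
      simpa using h
  exact measurable_snd.comp this

theorem measurable_bwd [StandardBorelSpace X] [StandardBorelSpace M]
    (hf : Measurable fun p : X × M => f p.1 p.2) (n : ℕ) :
    Measurable fun p : (ℤ → X) × M => bwd f p.1 n p.2 := by
  induction n with
  | zero => exact measurable_snd
  | succ n ih =>
    exact (measurable_symm hf).comp
      (((measurable_pi_apply (-((n : ℤ) + 1))).comp measurable_fst).prodMk ih)

theorem measurable_orbitMap [StandardBorelSpace X] [StandardBorelSpace M]
    (hf : Measurable fun p : X × M => f p.1 p.2) (z : ℤ) :
    Measurable fun p : (ℤ → X) × M => orbitMap f p.1 z p.2 := by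
  match z with
  | Int.ofNat n =>
    have h : Measurable fun p : (ℤ → X) × M => ((fun i : ℕ => p.1 i), p.2) :=
      Measurable.prodMk (measurable_pi_lambda _ fun i =>
        (measurable_pi_apply (i : ℤ)).comp measurable_fst) measurable_snd
    exact (measurable_fwd hf n).comp h
  | Int.negSucc n => exact measurable_bwd hf (n + 1)

theorem measurable_pastShift [StandardBorelSpace X] [StandardBorelSpace M]
    (hf : Measurable fun p : X × M => f p.1 p.2) (m : ℕ) : Measurable (pastShift f m) :=
  Measurable.prodMk (measurable_pi_lambda _ fun i =>
    (measurable_pi_apply ((i : ℤ) - m)).comp measurable_fst) (measurable_bwd hf m)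

/-! ### The invariant measure of the one-sided skew product -/

/-- The noise `θ^ℕ`. -/
noncomputable abbrev noise (θ : Measure X) : Measure (ℕ → X) := Measure.infinitePi fun _ : ℕ => θ

theorem map_cons_noise (θ : Measure X) [IsProbabilityMeasure θ] :
    (noise θ).map (fun w => (w 0, fun i => w (i + 1))) = θ.prod (noise θ) := by
  have hc : Measurable fun p : X × (ℕ → X) => (fun n => Nat.casesOn n p.1 p.2 : ℕ → X) := by
    refine measurable_pi_lambda _ fun n => ?_
    cases n with
    | zero => exact measurable_fst
    | succ n => exact (measurable_pi_apply n).comp measurable_snd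
  have key : (θ.prod (noise θ)).map (fun p : X × (ℕ → X) =>
      (fun n => Nat.casesOn n p.1 p.2 : ℕ → X)) = noise θ := by
    refine Measure.eq_infinitePi _ fun s t ht => ?_
    have hs : Measure.infinitePi (fun _ : ℕ => θ) (Set.pi s t) = ∏ i ∈ s, θ (t i) :=
      Measure.infinitePi_pi _ fun i _ => ht i
    classical
    -- Padding with `univ` turns a cylinder over `s` into one over an initial segment, from which
    -- coordinate `0` splits off.
    let t' : ℕ → Set X := fun i => if i ∈ s then t i else univ
    have ht' : ∀ i, MeasurableSet (t' i) := fun i => by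
      by_cases h : i ∈ s <;> simp [t', h, ht]
    obtain ⟨n, hn⟩ : ∃ n, s ⊆ Finset.range (n + 1) :=
      ⟨s.sup id, fun i hi => Finset.mem_range.2
        (Nat.lt_succ_of_le (Finset.le_sup (f := id) hi))⟩
    have e : (fun p : X × (ℕ → X) => (fun n => Nat.casesOn n p.1 p.2 : ℕ → X)) ⁻¹' Set.pi s t =
        t' 0 ×ˢ Set.pi (Finset.range n) fun i => t' (i + 1) := by
      ext ⟨a, w⟩
      simp only [mem_preimage, Set.mem_pi, Finset.mem_coe, mem_prod, Finset.mem_range]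
      constructor
      · intro h
        refine ⟨?_, fun i _ => ?_⟩
        · by_cases h0 : 0 ∈ s
          · simpa [t', h0] using h 0 h0
          · simp [t', h0]
        · by_cases h0 : i + 1 ∈ s
          · simpa [t', h0] using h _ h0
          · simp [t', h0]
      · rintro ⟨h0, h1⟩ i hi
        cases i with
        | zero => simpa [t', hi] using h0
        | succ i =>
          have := h1 i (by have := Finset.mem_range.1 (hn hi); omega)
          simpa [t', hi] using this
    rw [Measure.map_apply hc (MeasurableSet.pi s.countable_toSet fun i _ => ht i), e,
      Measure.prod_prod, noise, Measure.infinitePi_pi _ fun i _ => ht' (i + 1),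
      mul_comm, ← Finset.prod_range_succ' (fun i => θ (t' i)),
      ← Finset.prod_subset hn fun i _ hi => by simp [t', hi]]
    exact Finset.prod_congr rfl fun i hi => by simp [t', hi]
  rw [← key, Measure.map_map _ hc]
  · conv_rhs => rw [key, ← Measure.map_id (μ := θ.prod (noise θ))]
    rfl
  · exact (measurable_pi_apply 0).prodMk
      (measurable_pi_lambda _ fun i => measurable_pi_apply (i + 1))

/-- The first letter is independent of the shifted noise, and stationarity says that it carries `μ`
to `μ`; the rest is a rearrangement of product factors. -/
theorem measurePreserving_skew (hf : Measurable fun p : X × M => f p.1 p.2) {θ : Measure X}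
    [IsProbabilityMeasure θ] {μ : Measure M} [IsProbabilityMeasure μ]
    (hst : (θ.prod μ).map (fun p => f p.1 p.2) = μ) :
    MeasurePreserving (skew f) ((noise θ).prod μ) ((noise θ).prod μ) := by
  have h1 : MeasurePreserving (fun w : ℕ → X => (w 0, fun i => w (i + 1))) (noise θ)
      (θ.prod (noise θ)) := ⟨(measurable_pi_apply 0).prodMk
      (measurable_pi_lambda _ fun i => measurable_pi_apply (i + 1)), map_cons_noise θ⟩
  have h2 := h1.prod (MeasurePreserving.id μ)
  have h3 : MeasurePreserving (fun p : (X × (ℕ → X)) × M => ((p.1.2, p.1.1), p.2))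
      ((θ.prod (noise θ)).prod μ) (((noise θ).prod θ).prod μ) :=
    (Measure.measurePreserving_swap (μ := θ) (ν := noise θ)).prod (MeasurePreserving.id μ)
  have h4 : MeasurePreserving MeasurableEquiv.prodAssoc
      (((noise θ).prod θ).prod μ) ((noise θ).prod (θ.prod μ)) :=
    measurePreserving_prodAssoc (noise θ) θ μ
  have h5 : MeasurePreserving (fun p : X × M => f p.1 p.2) (θ.prod μ) μ := ⟨hf, hst⟩
  have h6 := (MeasurePreserving.id (noise θ)).prod h5
  exact h6.comp (h4.comp (h3.comp h2))

theorem measurePreserving_skew_iterate (hf : Measurable fun p : X × M => f p.1 p.2)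
    {θ : Measure X} [IsProbabilityMeasure θ] {μ : Measure M} [IsProbabilityMeasure μ]
    (hst : (θ.prod μ).map (fun p => f p.1 p.2) = μ) (n : ℕ) :
    MeasurePreserving (fun p : (ℕ → X) × M => ((fun i => p.1 (i + n), fwd f p.1 n p.2) :
      (ℕ → X) × M)) ((noise θ).prod μ) ((noise θ).prod μ) := by
  have h := (measurePreserving_skew hf hst).iterate n
  have e : (skew f)^[n] = fun p : (ℕ → X) × M => ((fun i => p.1 (i + n), fwd f p.1 n p.2) :
      (ℕ → X) × M) := funext fun p => skew_iterate f n p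
  rwa [e] at h

end MeasurableMaps

section ContinuousMaps

variable {X M : Type*} [TopologicalSpace X] [TopologicalSpace M] {f : X → M ≃ M}

theorem continuous_fwd (hf : Continuous fun p : X × M => f p.1 p.2) (n : ℕ) :
    Continuous fun p : (ℕ → X) × M => fwd f p.1 n p.2 := by
  induction n with
  | zero => exact continuous_snd
  | succ n ih =>
    exact hf.comp (((continuous_apply n).comp continuous_fst).prodMk ih)

end ContinuousMaps

/-! ### The invariant measure of the two-sided skew product -/

section NaturalExtension

variable {X M : Type*} [MetricSpace X] [CompactSpace X] [MeasurableSpace X] [BorelSpace X]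
  [MetricSpace M] [SigmaCompactSpace M] [SecondCountableTopology M] [MeasurableSpace M]
  [BorelSpace M] {f : X → M ≃ M}

theorem map_shift_noise {X : Type*} [MeasurableSpace X] (θ : Measure X) [IsProbabilityMeasure θ]
    (m : ℕ) :
    (Measure.infinitePi fun _ : ℤ => θ).map (fun w (i : ℕ) => w ((i : ℤ) - m)) = noise θ :=
  Measure.map_infinitePi_infinitePi_of_inj (P := fun _ : ℤ => θ)
    (f := fun i : ℕ => (i : ℤ) - m) fun a b h => by simpa using h

/-- A point of law `μ`, independent of the noise, is started at time `-n` and moved to time `0`.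
Both marginals of the resulting laws are fixed, so the laws are tight; any limit point as `n → ∞`
serves as `P`, since what is seen from time `-m` on has the same law for all `n ≥ m`. -/
theorem exists_naturalExtension [LocallyCompactSpace M]
    (hf : Continuous fun p : X × M => f p.1 p.2) {θ : Measure X}
    [IsProbabilityMeasure θ] {μ : Measure M} [IsProbabilityMeasure μ]
    (hst : (θ.prod μ).map (fun p => f p.1 p.2) = μ) :
    ∃ P : Measure ((ℤ → X) × M), IsProbabilityMeasure P ∧
      P.map Prod.fst = Measure.infinitePi (fun _ : ℤ => θ) ∧
      ∀ m, P.map (pastShift f m) = (noise θ).prod μ := by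
  have : StandardBorelSpace M := standardBorelSpace_of_sigmaCompact M
  have hfm : Measurable fun p : X × M => f p.1 p.2 := hf.measurable
  set Z : Measure (ℤ → X) := Measure.infinitePi fun _ : ℤ => θ with hZ
  let s : ℕ → (ℤ → X) → ℕ → X := fun m w i => w ((i : ℤ) - m)
  have hsc : ∀ m, Continuous (s m) := fun m => continuous_pi fun i => continuous_apply _
  let R : ℕ → (ℤ → X) × M → (ℤ → X) × M := fun m p => (p.1, fwd f (s m p.1) m p.2)
  have hRc : ∀ m, Continuous (R m) := fun m => continuous_fst.prodMk
    ((continuous_fwd hf m).comp (((hsc m).comp continuous_fst).prodMk continuous_snd))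
  let P : ℕ → ProbabilityMeasure ((ℤ → X) × M) := fun m =>
    ⟨(Z.prod μ).map (R m), Measure.isProbabilityMeasure_map (hRc m).measurable.aemeasurable⟩
  have hPfst : ∀ m, ((P m : ProbabilityMeasure _) : Measure ((ℤ → X) × M)).map Prod.fst = Z := by
    intro m
    change ((Z.prod μ).map (R m)).map Prod.fst = Z
    rw [Measure.map_map measurable_fst (hRc m).measurable]
    exact Measure.fst_prod
  have hsnd : ∀ n, ((noise θ).prod μ).map (fun p : (ℕ → X) × M => fwd f p.1 n p.2) = μ := by
    intro n
    have h := (measurePreserving_skew_iterate hfm hst n).map_eq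
    have h' := congrArg (Measure.map Prod.snd) h
    rw [Measure.map_map measurable_snd (measurePreserving_skew_iterate hfm hst n).measurable] at h'
    exact h'.trans Measure.snd_prod
  have hmp : ∀ m, MeasurePreserving (fun p : (ℤ → X) × M => (s m p.1, p.2)) (Z.prod μ)
      ((noise θ).prod μ) := fun m =>
    MeasurePreserving.prod (⟨(hsc m).measurable, map_shift_noise θ m⟩ : MeasurePreserving _ _ _)
      (MeasurePreserving.id μ)
  have hPsnd : ∀ m, ((P m : ProbabilityMeasure _) : Measure ((ℤ → X) × M)).map Prod.snd = μ := by
    intro m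
    change ((Z.prod μ).map (R m)).map Prod.snd = μ
    rw [Measure.map_map measurable_snd (hRc m).measurable]
    have h := hsnd m
    rw [← (hmp m).map_eq, Measure.map_map (measurable_fwd hfm m) (hmp m).measurable] at h
    exact h
  let A : ℕ → (ℤ → X) × M → (ℕ → X) × M := fun m p => (s m p.1, p.2)
  have hAc : ∀ m, Continuous (A m) := fun m =>
    ((hsc m).comp continuous_fst).prodMk continuous_snd
  let Q : ℕ → (ℕ → X) × M → (ℕ → X) × M := fun m p => (p.1, fwd f p.1 m p.2)
  have hQm : ∀ m, Measurable (Q m) := fun m => measurable_fst.prodMk (measurable_fwd hfm m)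
  have hPA : ∀ m n, m ≤ n → ((P n : ProbabilityMeasure _) : Measure ((ℤ → X) × M)).map (A m) =
      ((noise θ).prod μ).map (Q m) := by
    intro m n hmn
    obtain ⟨r, rfl⟩ := Nat.exists_eq_add_of_le' hmn
    change ((Z.prod μ).map (R (r + m))).map (A m) = _
    rw [Measure.map_map (hAc m).measurable (hRc _).measurable]
    have h1 := (measurePreserving_skew_iterate hfm hst r).comp (hmp (r + m))
    rw [← h1.map_eq, Measure.map_map (hQm m) h1.measurable]
    congr 1
    funext p
    have e : (fun i => s (r + m) p.1 (i + r)) = s m p.1 := by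
      funext i
      exact congrArg p.1 (by push_cast; ring)
    simp only [Function.comp_apply, A, R, Q, e, fwd_add]
  -- a limit point of the sequence `P`
  have htight : IsTightMeasureSet {((ν : ProbabilityMeasure _) : Measure ((ℤ → X) × M)) |
      ν ∈ range P} := by
    refine IsTightMeasureSet.prodMk .of_compactSpace ?_
    refine (isTightMeasureSet_singleton_of_innerRegular (μ := μ)).subset ?_
    rintro _ ⟨_, ⟨_, ⟨m, rfl⟩, rfl⟩, rfl⟩
    exact hPsnd m
  have hcpt := isCompact_closure_of_isTightMeasureSet htight
  obtain ⟨Plim, -, hPlim⟩ := hcpt.ultrafilter_le_nhds ((hyperfilter ℕ).map P) (by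
    rw [le_principal_iff]
    exact mem_of_superset (Filter.range_mem_map) subset_closure)
  have hlim : Tendsto P (hyperfilter ℕ) (𝓝 Plim) := hPlim
  have hmapA : ∀ m, (Plim : Measure ((ℤ → X) × M)).map (A m) = ((noise θ).prod μ).map (Q m) := by
    intro m
    have h1 := ProbabilityMeasure.tendsto_map_of_tendsto_of_continuous _ _ hlim (hAc m)
    let T : ProbabilityMeasure ((ℕ → X) × M) := ⟨((noise θ).prod μ).map (Q m),
      Measure.isProbabilityMeasure_map (hQm m).aemeasurable⟩
    have h2 : ∀ᶠ n in (hyperfilter ℕ : Filter ℕ),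
        (P n).map (hAc m).measurable.aemeasurable = T := by
      have : ∀ᶠ n in (atTop : Filter ℕ), (P n).map (hAc m).measurable.aemeasurable = T := by
        filter_upwards [eventually_ge_atTop m] with n hn
        exact Subtype.ext (hPA m n hn)
      exact Nat.hyperfilter_le_atTop this
    have h3 := tendsto_nhds_unique (tendsto_const_nhds.congr' (h2.mono fun _ h => h.symm)) h1
    exact (congrArg (fun ν : ProbabilityMeasure _ => (ν : Measure ((ℕ → X) × M))) h3).symm
  refine ⟨Plim, inferInstance, ?_, fun m => ?_⟩
  · have h1 := ProbabilityMeasure.tendsto_map_of_tendsto_of_continuous _ _ hlim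
      (continuous_fst (X := ℤ → X) (Y := M))
    let T : ProbabilityMeasure (ℤ → X) := ⟨Z, inferInstance⟩
    have h2 : ∀ n, (P n).map (continuous_fst (X := ℤ → X) (Y := M)).measurable.aemeasurable = T :=
      fun n => Subtype.ext (hPfst n)
    simp only [h2] at h1
    have h3 := tendsto_nhds_unique h1 tendsto_const_nhds
    exact congrArg (fun ν : ProbabilityMeasure _ => (ν : Measure (ℤ → X))) h3
  -- The backward maps are only known to be measurable, so the limit was taken through the
  -- continuous `A m` and is pulled back to time `-m` afterwards. The values that `toNat` invents
  -- before time `-m` are never read by `bwd` at depth `m`.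
  · let B : (ℕ → X) × M → (ℕ → X) × M := fun p =>
      (p.1, bwd f (fun z : ℤ => p.1 (z + m).toNat) m p.2)
    have hext : Measurable fun p : (ℕ → X) × M => ((fun z : ℤ => p.1 (z + m).toNat : ℤ → X), p.2) :=
      Measurable.prodMk (measurable_pi_lambda _ fun z =>
        (measurable_pi_apply _).comp measurable_fst) measurable_snd
    have hBm : Measurable B := measurable_fst.prodMk ((measurable_bwd hfm m).comp hext)
    have e1 : pastShift f m = B ∘ A m := by
      funext p
      simp only [Function.comp_apply, A, B, pastShift, s]
      congr 1
      refine bwd_congr f m (fun i hi => ?_) _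
      exact congrArg p.1 (by omega)
    have e2 : B ∘ Q m = id := by
      funext p
      have hb := bwd_fwd f (fun z : ℤ => p.1 (z + m).toNat) m p.2
      simp only [sub_add_cancel, Int.toNat_natCast] at hb
      simp only [Function.comp_apply, B, Q, hb, id]
    rw [e1, ← Measure.map_map hBm (hAc m).measurable, hmapA, Measure.map_map hBm (hQm m), e2,
      Measure.map_id]

end NaturalExtension

/-! ### Sets approximable along a sequence of σ-algebras -/

/-- The σ-algebra of the sets which can be approximated, up to small `P`-measure, by members of
`𝓖 m` for all large `m`. -/
@[reducible]
def approxSigma {Y : Type*} [MeasurableSpace Y] (P : Measure Y) [IsFiniteMeasure P]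
    (𝓖 : ℕ → MeasurableSpace Y) : MeasurableSpace Y where
  MeasurableSet' A := MeasurableSet A ∧ ∀ δ : ℝ≥0∞, 0 < δ → ∀ᶠ m in atTop,
    ∃ D, MeasurableSet[𝓖 m] D ∧ P (symmDiff A D) ≤ δ
  measurableSet_empty := ⟨.empty, fun δ _ => .of_forall fun m =>
    ⟨∅, @MeasurableSet.empty _ (𝓖 m), by simp⟩⟩
  measurableSet_compl A hA := ⟨hA.1.compl, fun δ hδ => (hA.2 δ hδ).mono fun m ⟨D, hD, h⟩ =>
    ⟨Dᶜ, hD.compl, by rwa [compl_symmDiff_compl]⟩⟩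
  measurableSet_iUnion A hA := by
    refine ⟨.iUnion fun i => (hA i).1, fun δ hδ => ?_⟩
    have hδ2 : 0 < δ / 2 := ENNReal.half_pos hδ.ne'
    have hR : Tendsto (fun n => P ((⋃ i, A i) \ accumulate A n)) atTop (𝓝 0) := by
      have h := tendsto_measure_iInter_atTop (μ := P) (s := fun n => (⋃ i, A i) \ accumulate A n)
        (fun n => ((MeasurableSet.iUnion fun i => (hA i).1).diff
          (MeasurableSet.biUnion (to_countable _) fun i _ => (hA i).1)).nullMeasurableSet)
        (fun a b hab => sdiff_subset_sdiff_right (monotone_accumulate hab)) ⟨0, measure_ne_top _ _⟩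
      have e : ⋂ n, (⋃ i, A i) \ accumulate A n = ∅ := by
        rw [← sdiff_iUnion, iUnion_accumulate, sdiff_self]
      rwa [e, measure_empty] at h
    -- Half of `δ` pays for the tail of the union, the other half for approximating the first `n +
    -- 1` sets simultaneously.
    obtain ⟨n, hn⟩ := (hR.eventually (gt_mem_nhds hδ2)).exists
    have hd : 0 < δ / 2 / (n + 1 : ℕ) := ENNReal.div_pos hδ2.ne' (ENNReal.natCast_ne_top _)
    have hall : ∀ᶠ m in atTop, ∀ i ∈ Finset.range (n + 1), ∃ D, MeasurableSet[𝓖 m] D ∧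
        P (symmDiff (A i) D) ≤ δ / 2 / (n + 1 : ℕ) :=
      (Finset.eventually_all _).2 fun i _ => (hA i).2 _ hd
    filter_upwards [hall] with m hm
    choose! D hD hDδ using hm
    refine ⟨⋃ i ∈ Finset.range (n + 1), D i,
      @Finset.measurableSet_biUnion _ _ (𝓖 m) _ _ fun i hi => hD i hi, ?_⟩
    have hsub : symmDiff (⋃ i, A i) (⋃ i ∈ Finset.range (n + 1), D i) ⊆
        ((⋃ i, A i) \ accumulate A n) ∪ ⋃ i ∈ Finset.range (n + 1), symmDiff (A i) (D i) := by
      intro x hx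
      simp only [mem_symmDiff, mem_iUnion, mem_union, Set.mem_sdiff, mem_accumulate, Finset.mem_range,
        Nat.lt_succ_iff, exists_prop, not_exists, not_and] at hx ⊢
      rcases hx with ⟨⟨i, hi⟩, h⟩ | ⟨⟨i, hi, hxi⟩, h⟩
      · by_cases h' : ∃ j ≤ n, x ∈ A j
        · obtain ⟨j, hj, hxj⟩ := h'
          exact Or.inr ⟨j, hj, Or.inl ⟨hxj, h j hj⟩⟩
        · push Not at h'
          exact Or.inl ⟨⟨i, hi⟩, h'⟩
      · exact Or.inr ⟨i, hi, Or.inr ⟨hxi, h i⟩⟩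
    calc _ ≤ P ((⋃ i, A i) \ accumulate A n) +
          ∑ i ∈ Finset.range (n + 1), P (symmDiff (A i) (D i)) :=
        (measure_mono hsub).trans ((measure_union_le _ _).trans (by
          gcongr; exact measure_biUnion_finset_le _ _))
      _ ≤ δ / 2 + ∑ _i ∈ Finset.range (n + 1), δ / 2 / (n + 1 : ℕ) := by
        gcongr with i hi
        exact hDδ i hi
      _ ≤ δ := by
        rw [Finset.sum_const, Finset.card_range, nsmul_eq_mul]
        refine (add_le_add le_rfl ENNReal.mul_div_le).trans (ENNReal.add_halves δ).le

theorem measurableSet_approxSigma {Y : Type*} [MeasurableSpace Y] {P : Measure Y}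
    [IsFiniteMeasure P] {𝓖 : ℕ → MeasurableSpace Y} {A : Set Y} (hA : MeasurableSet A)
    (h : ∀ᶠ m in atTop, MeasurableSet[𝓖 m] A) : MeasurableSet[approxSigma P 𝓖] A :=
  ⟨hA, fun _ _ => h.mono fun _ hm => ⟨A, hm, by simp⟩⟩

/-- If an indexed family of measurable sets `D` is given, there is a measurable way of choosing an
index `i` with `q ∈ D i`. -/
theorem exists_measurable_index {Y κ : Type*} [MeasurableSpace Y] [Finite κ] [Nonempty κ]
    [MeasurableSpace κ] [DiscreteMeasurableSpace κ] {D : κ → Set Y}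
    (hD : ∀ i, MeasurableSet (D i)) :
    ∃ g : Y → κ, Measurable g ∧ ∀ q, (∃ i, q ∈ D i) → q ∈ D (g q) := by
  classical
  let G : (κ → Prop) → κ := fun v => if h : ∃ i, v i then h.choose else Classical.arbitrary κ
  refine ⟨fun q => G fun i => q ∈ D i, ?_, fun q h => ?_⟩
  · have hG : Measurable G := .of_discrete
    exact hG.comp (measurable_pi_lambda _ fun i => measurable_mem.2 (hD i))
  · simp only [G, dif_pos h]
    exact h.choose_spec

/-! ### Predicting a label from a finite window of the itinerary -/

section Generating

variable {X M : Type*} {f : X → M ≃ M}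

/-- The sets that do not separate `x` from `y` form a σ-algebra, which contains the generators. -/
theorem mem_iff_of_orbitSigma {k : ℕ} {ξ : Fin k → Set M} {w : ℤ → X} {x y : M}
    (h : ∀ (z : ℤ) (i : Fin k), orbitMap f w z x ∈ ξ i ↔ orbitMap f w z y ∈ ξ i) {B : Set M}
    (hB : MeasurableSet[orbitSigma f w ξ] B) : x ∈ B ↔ y ∈ B := by
  induction B, hB using MeasurableSpace.generateFrom_induction with
  | hC t ht _ =>
    obtain ⟨z, i, rfl⟩ := ht
    exact h z i
  | empty => simp
  | compl t _ ih => exact not_congr ih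
  | iUnion s _ ih => simp only [mem_iUnion, ih]

end Generating

section Guess

variable {X M : Type*} [MetricSpace X] [CompactSpace X] [MeasurableSpace X] [BorelSpace X]
  [MetricSpace M] [SigmaCompactSpace M] [SecondCountableTopology M] [MeasurableSpace M]
  [BorelSpace M] [LocallyCompactSpace M] {f : X → M ≃ M}

/-- Noise and two-sided itinerary determine the point almost surely, so by Lusin–Souslin the label
`e` is a measurable function of them. Finite windows approximate such a function, and moving the
origin to time `-m` makes the window one-sided. -/
theorem exists_guess (hf : Continuous fun p : X × M => f p.1 p.2) {θ : Measure X}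
    [IsProbabilityMeasure θ] {μ : Measure M} [IsProbabilityMeasure μ]
    (hst : (θ.prod μ).map (fun p => f p.1 p.2) = μ)
    {ι : Type*} [Finite ι] [MeasurableSpace ι] [DiscreteMeasurableSpace ι] {c : M → ι}
    (hc : Measurable c)
    {κ : Type*} [Finite κ] [Nonempty κ] [MeasurableSpace κ] [DiscreteMeasurableSpace κ] {e : M → κ}
    (he : Measurable e) {k : ℕ} {ξ : Fin k → Set M} {N Z : Set M}
    (hNμ : μ N = 0) (hZμ : μ Z = 0)
    (hcξ : ∀ x ∉ Z, ∀ y ∉ Z, c x = c y → ∀ i, x ∈ ξ i ↔ y ∈ ξ i)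
    (hgen : ∀ᵐ w ∂(Measure.infinitePi fun _ : ℤ => θ), ∀ A : Set M, MeasurableSet A →
      ∃ B : Set M, MeasurableSet[orbitSigma f w ξ] B ∧ A \ N = B \ N)
    {δ : ℝ≥0∞} (hδ : 0 < δ) :
    ∃ (m : ℕ) (g : (ℕ → X) × (Fin (2 * m + 1) → ι) → κ), Measurable g ∧
      ((noise θ).prod μ) {p | e (fwd f p.1 m p.2) ≠
        g (p.1, fun j => c (fwd f p.1 j p.2))} ≤ δ := by
  have : StandardBorelSpace M := standardBorelSpace_of_sigmaCompact M
  have hfm : Measurable fun p : X × M => f p.1 p.2 := hf.measurable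
  obtain ⟨P, hP, hPfst, hPpast⟩ := exists_naturalExtension hf hst
  have hPae : ∀ m, ∀ {p : (ℕ → X) × M → Prop}, (∀ᵐ q ∂(noise θ).prod μ, p q) →
      ∀ᵐ q ∂P, p (pastShift f m q) := fun m p h => by
    rw [← hPpast m] at h
    exact ae_of_ae_map (measurable_pastShift hfm m).aemeasurable h
  have hsnd : ∀ {A : Set M}, μ A = 0 → ∀ᵐ q ∂(noise θ).prod μ, q.2 ∉ A := fun {A} hA =>
    Measure.quasiMeasurePreserving_snd.ae (μb := μ) (measure_eq_zero_iff_ae_notMem.1 hA)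
  -- a full measure set on which the itinerary map is injective
  have hgood : ∀ᵐ p ∂P, (∀ A : Set M, MeasurableSet A →
      ∃ B : Set M, MeasurableSet[orbitSigma f p.1 ξ] B ∧ A \ N = B \ N) ∧ p.2 ∉ N ∧
      ∀ z, orbitMap f p.1 z p.2 ∉ Z := by
    refine .and ?_ (.and ?_ (ae_all_iff.2 fun z => ?_))
    · rw [← hPfst] at hgen
      exact ae_of_ae_map measurable_fst.aemeasurable hgen
    · exact hPae 0 (hsnd hNμ)
    -- Time `z` is reached from the past time `-|z|` by `z + |z| ≥ 0` forward steps.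
    · have h := (measurePreserving_skew_iterate hfm hst (z + z.natAbs).toNat).quasiMeasurePreserving.ae
        (hsnd hZμ)
      filter_upwards [hPae z.natAbs h] with p hp
      simp only [pastShift, fwd_bwd] at hp
      have ez : (((z + z.natAbs).toNat : ℕ) : ℤ) - z.natAbs = z := by omega
      rwa [ez] at hp
  -- The good points need not form a measurable set, and Lusin–Souslin needs a Borel domain.
  obtain ⟨Bad, hBad, hBadm, hBad0⟩ := exists_measurable_superset_of_null hgood
  set Gd := Badᶜ with hGd
  have hGdm : MeasurableSet Gd := hBadm.compl
  have hGdp : ∀ p ∈ Gd, (∀ A : Set M, MeasurableSet A →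
      ∃ B : Set M, MeasurableSet[orbitSigma f p.1 ξ] B ∧ A \ N = B \ N) ∧ p.2 ∉ N ∧
      ∀ z, orbitMap f p.1 z p.2 ∉ Z := fun p hp => by
    by_contra h
    exact hp (hBad h)
  let T : (ℤ → X) × M → (ℤ → X) × (ℤ → ι) := fun p => (p.1, fun z => c (orbitMap f p.1 z p.2))
  have hT : Measurable T := measurable_fst.prodMk
    (measurable_pi_lambda _ fun z => hc.comp (measurable_orbitMap hfm z))
  have hTinj : InjOn T Gd := by
    rintro ⟨w, x⟩ hx ⟨w', y⟩ hy h
    simp only [T, Prod.mk.injEq] at h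
    obtain ⟨rfl, h⟩ := h
    obtain ⟨hg, hxN, hxZ⟩ := hGdp _ hx
    obtain ⟨-, hyN, hyZ⟩ := hGdp _ hy
    -- Outside `N`, the generated σ-algebra isolates the point `x`, while points with equal
    -- itineraries cannot be separated.
    obtain ⟨B, hB, hAB⟩ := hg {x} (measurableSet_singleton x)
    have hxB : x ∈ B \ N := hAB ▸ ⟨rfl, hxN⟩
    have hyB : y ∈ B := (mem_iff_of_orbitSigma
      (fun z i => hcξ _ (hxZ z) _ (hyZ z) (congrFun h z) i) hB).1 hxB.1
    have : y ∈ ({x} : Set M) \ N := hAB ▸ ⟨hyB, hyN⟩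
    rw [show y = x from this.1]
  let B : κ → Set ((ℤ → X) × (ℤ → ι)) := fun i => T '' (Gd ∩ {p | e p.2 = i})
  have hB : ∀ i, MeasurableSet (B i) := fun i =>
    (hGdm.inter ((he.comp measurable_snd) (measurableSet_singleton i))).image_of_measurable_injOn
      hT (hTinj.mono inter_subset_left)
  have hTB : ∀ p ∈ Gd, ∀ i, T p ∈ B i ↔ e p.2 = i := by
    refine fun p hp i => ⟨?_, fun h => ⟨p, ⟨hp, h⟩, rfl⟩⟩
    rintro ⟨q, ⟨hq, hqi⟩, hqp⟩
    rw [← hTinj hq hp hqp]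
    exact hqi
  -- finite windows
  let W : ∀ m : ℕ, (ℤ → X) × M → (ℕ → X) × (Fin (2 * m + 1) → ι) := fun m p =>
    (fun i => p.1 ((i : ℤ) - m), fun j => c (orbitMap f p.1 ((j : ℕ) - m : ℤ) p.2))
  let 𝓖 : ℕ → MeasurableSpace ((ℤ → X) × M) := fun m => MeasurableSpace.comap (W m) inferInstance
  -- Each coordinate of `T` is read exactly in all large windows; since the approximable sets form a
  -- σ-algebra, every event depending on `T` is approximable.
  have hTa : @Measurable _ _ (approxSigma P 𝓖) _ T := by
    refine @Measurable.prodMk _ (approxSigma P 𝓖) _ _ _ _ (fun p => p.1)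
      (fun p z => c (orbitMap f p.1 z p.2))
      ((@measurable_pi_iff _ _ _ (approxSigma P 𝓖) _ _).2 fun z => ?_)
      ((@measurable_pi_iff _ _ _ (approxSigma P 𝓖) _ _).2 fun z => ?_)
    · intro S hS
      refine measurableSet_approxSigma (((measurable_pi_apply z).comp measurable_fst) hS) ?_
      filter_upwards [eventually_ge_atTop z.natAbs] with m hm
      refine ⟨{q | q.1 (z + m).toNat ∈ S}, ((measurable_pi_apply _).comp measurable_fst) hS, ?_⟩
      have ez : (((z + m).toNat : ℕ) : ℤ) - m = z := by omega
      ext p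
      simp only [W, mem_preimage, mem_ofPred_eq, ez]
    · intro S hS
      refine measurableSet_approxSigma ((hc.comp (measurable_orbitMap hfm z)) hS) ?_
      filter_upwards [eventually_ge_atTop z.natAbs] with m hm
      have hz : (z + m).toNat < 2 * m + 1 := by omega
      have hms : Measurable fun q : (ℕ → X) × (Fin (2 * m + 1) → ι) => q.2 ⟨(z + m).toNat, hz⟩ :=
        (measurable_pi_apply _).comp measurable_snd
      refine ⟨{q | q.2 ⟨(z + m).toNat, hz⟩ ∈ S}, hms hS, ?_⟩
      have ez : (((z + m).toNat : ℕ) : ℤ) - m = z := by omega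
      ext p
      simp only [W, mem_preimage, mem_ofPred_eq, ez]
  have := Fintype.ofFinite κ
  obtain ⟨δ', hδ', hδδ⟩ : ∃ δ' : ℝ≥0∞, 0 < δ' ∧ Fintype.card κ * δ' ≤ δ :=
    ⟨δ / Fintype.card κ, ENNReal.div_pos hδ.ne' (ENNReal.natCast_ne_top _), ENNReal.mul_div_le⟩
  obtain ⟨m, hm⟩ := (eventually_all.2 fun i => (hTa (hB i)).2 δ' hδ').exists
  choose D' hD' hDδ using hm
  choose D hD hDD using hD'
  obtain ⟨g, hg, hgD⟩ := exists_measurable_index hD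
  refine ⟨m, g, hg, ?_⟩
  have hSm : MeasurableSet {p : (ℕ → X) × M | e (fwd f p.1 m p.2) ≠
      g (p.1, fun j => c (fwd f p.1 j p.2))} := by
    refine (measurableSet_eq_fun (he.comp (measurable_fwd hfm m)) (hg.comp ?_)).compl
    exact measurable_fst.prodMk
      (measurable_pi_lambda _ fun j => hc.comp (measurable_fwd hfm j))
  rw [← hPpast m, Measure.map_apply (measurable_pastShift hfm m) hSm]
  have hsub : pastShift f m ⁻¹' {p : (ℕ → X) × M | e (fwd f p.1 m p.2) ≠
      g (p.1, fun j => c (fwd f p.1 j p.2))} ⊆ Bad ∪ ⋃ i, symmDiff (T ⁻¹' B i) (D' i) := by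
    intro p hp
    by_contra hcon
    simp only [mem_union, mem_iUnion, not_or, not_exists] at hcon
    obtain ⟨hp1, hp2⟩ := hcon
    have hiff : ∀ i, e p.2 = i ↔ W m p ∈ D i := fun i => by
      rw [← hTB p hp1 i]
      have := hp2 i
      rw [← hDD i, mem_symmDiff] at this
      simp only [mem_preimage] at this
      tauto
    apply hp
    simp only [pastShift, fwd_bwd, sub_self]
    exact (hiff _).2 (hgD (W m p) ⟨e p.2, (hiff _).1 rfl⟩)
  calc P _ ≤ P (Bad ∪ ⋃ i, symmDiff (T ⁻¹' B i) (D' i)) := measure_mono hsub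
    _ ≤ P Bad + ∑ i, P (symmDiff (T ⁻¹' B i) (D' i)) :=
      (measure_union_le _ _).trans (by gcongr; exact measure_iUnion_fintype_le _ _)
    _ ≤ 0 + ∑ _i : κ, δ' := by
      gcongr with i
      · exact hBad0.le
      · exact hDδ i
    _ ≤ δ := by simpa using hδδ

end Guess

/-! ### Gibbs' inequality -/

theorem ofReal_sum_le {α : Type*} (s : Finset α) (a : α → ℝ) :
    ENNReal.ofReal (∑ i ∈ s, a i) ≤ ∑ i ∈ s, ENNReal.ofReal (a i) :=
  Finset.le_sum_of_subadditive _ ENNReal.ofReal_zero.le (fun _ _ => ENNReal.ofReal_add_le) _ _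

/-- Apply `log t ≤ t - 1` to `t = q y s / ∑ s, p y s`. Since `p y s` is at most that marginal, the
auxiliary variable `s` is discarded in the same stroke. -/
theorem sum_negMulLog_le {S S' : Type*} [Fintype S] [Fintype S'] {p q : S → S' → ℝ}
    (hp : ∀ y s, 0 ≤ p y s) (hq : ∀ y s, 0 ≤ q y s) (hpq : ∀ y s, p y s ≠ 0 → 0 < q y s)
    (hsum : ∑ y, ∑ s, q y s ≤ ∑ y, ∑ s, p y s) :
    ∑ y, Real.negMulLog (∑ s, p y s) ≤ ∑ y, ∑ s, p y s * -Real.log (q y s) := by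
  have key : ∀ y s, -(p y s) * Real.log (∑ s, p y s) ≤
      p y s * -Real.log (q y s) + (q y s - p y s) := by
    intro y s
    rcases eq_or_ne (p y s) 0 with h0 | h0
    · simp [h0, hq y s]
    have hpos : 0 < p y s := lt_of_le_of_ne (hp y s) h0.symm
    have hqpos := hpq y s h0
    have hle : p y s ≤ ∑ s, p y s := Finset.single_le_sum (fun s _ => hp y s) (Finset.mem_univ s)
    have hSpos : 0 < ∑ s, p y s := hpos.trans_le hle
    have hlog := Real.log_le_sub_one_of_pos (div_pos hqpos hSpos)
    rw [Real.log_div hqpos.ne' hSpos.ne'] at hlog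
    have h1 : p y s * (q y s / ∑ s, p y s) ≤ q y s := by
      rw [mul_div_assoc', div_le_iff₀ hSpos, mul_comm]
      gcongr
    nlinarith [mul_le_mul_of_nonneg_left hlog hpos.le]
  calc ∑ y, Real.negMulLog (∑ s, p y s)
      = ∑ y, ∑ s, -(p y s) * Real.log (∑ s, p y s) := by
        refine Finset.sum_congr rfl fun y _ => ?_
        rw [Real.negMulLog, ← Finset.sum_mul, Finset.sum_neg_distrib]
    _ ≤ ∑ y, ∑ s, (p y s * -Real.log (q y s) + (q y s - p y s)) :=
        Finset.sum_le_sum fun y _ => Finset.sum_le_sum fun s _ => key y s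
    _ ≤ ∑ y, ∑ s, p y s * -Real.log (q y s) := by
        simp only [Finset.sum_add_distrib, Finset.sum_sub_distrib]
        linarith

theorem ofReal_entropy_le_lintegral {M S S' : Type*} [MeasurableSpace M] [Fintype S] [Fintype S']
    [MeasurableSpace S] [MeasurableSpace S'] [DiscreteMeasurableSpace S]
    [DiscreteMeasurableSpace S'] {μ : Measure M} [IsProbabilityMeasure μ] {Y : M → S} {W : M → S'}
    (hY : Measurable Y) (hW : Measurable W) {q : S → S' → ℝ} (hq : ∀ y s, 0 ≤ q y s)
    (hsum : ∑ y, ∑ s, q y s ≤ 1) (hpos : ∀ᵐ x ∂μ, 0 < q (Y x) (W x)) :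
    ENNReal.ofReal (∑ y, Real.negMulLog (μ.real (Y ⁻¹' {y}))) ≤
      ∫⁻ x, ENNReal.ofReal (-Real.log (q (Y x) (W x))) ∂μ := by
  have hYW : Measurable fun x => (Y x, W x) := hY.prodMk hW
  set p : S → S' → ℝ := fun y s => (μ.map fun x => (Y x, W x)).real {(y, s)} with hpdef
  have hprob : IsProbabilityMeasure (μ.map fun x => (Y x, W x)) :=
    Measure.isProbabilityMeasure_map hYW.aemeasurable
  have hmarg : ∀ y, ∑ s, p y s = μ.real (Y ⁻¹' {y}) := by
    intro y
    classical
    have e : Y ⁻¹' {y} = (fun x => (Y x, W x)) ⁻¹' ↑(Finset.univ.image fun s : S' => (y, s)) := by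
      ext x
      simp [eq_comm]
    rw [e, ← map_measureReal_apply hYW (Finset.measurableSet _), ← sum_measureReal_singleton,
      Finset.sum_image fun a _ b _ h => (Prod.mk.inj h).2]
  have hq1 : ∀ y s, q y s ≤ 1 := fun y s =>
    ((Finset.single_le_sum (fun s _ => hq y s) (Finset.mem_univ s)).trans
      (Finset.single_le_sum (f := fun y => ∑ s, q y s)
        (fun y _ => Finset.sum_nonneg fun s _ => hq y s) (Finset.mem_univ y))).trans hsum
  have hlog : ∀ y s, 0 ≤ -Real.log (q y s) := fun y s =>
    neg_nonneg.2 (Real.log_nonpos (hq y s) (hq1 y s))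
  have hrhs : ∫⁻ x, ENNReal.ofReal (-Real.log (q (Y x) (W x))) ∂μ =
      ENNReal.ofReal (∑ y, ∑ s, p y s * -Real.log (q y s)) := by
    have h := lintegral_map (μ := μ) (f := fun z : S × S' => ENNReal.ofReal (-Real.log (q z.1 z.2)))
      (.of_discrete) hYW
    rw [← h, lintegral_fintype, Fintype.sum_prod_type, ENNReal.ofReal_sum_of_nonneg
      fun y _ => Finset.sum_nonneg fun s _ => mul_nonneg measureReal_nonneg (hlog y s)]
    refine Finset.sum_congr rfl fun y _ => ?_
    rw [ENNReal.ofReal_sum_of_nonneg fun s _ => mul_nonneg measureReal_nonneg (hlog y s)]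
    refine Finset.sum_congr rfl fun s _ => ?_
    rw [ENNReal.ofReal_mul measureReal_nonneg, ofReal_measureReal, mul_comm]
  rw [hrhs]
  refine ENNReal.ofReal_le_ofReal ?_
  simp only [← hmarg]
  refine sum_negMulLog_le (fun y s => measureReal_nonneg) hq (fun y s h => ?_) ?_
  · by_contra hn
    apply h
    have hn0 : q y s ≤ 0 := not_lt.1 hn
    rw [hpdef]
    simp only [map_measureReal_apply hYW (measurableSet_singleton _)]
    rw [measureReal_eq_zero_iff]
    refine measure_mono_null (fun x hx => ?_) hpos
    simp only [mem_preimage, mem_singleton_iff, Prod.mk.injEq] at hx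
    intro h'
    change 0 < q (Y x) (W x) at h'
    rw [hx.1, hx.2] at h'
    exact hn h'
  · refine hsum.trans (le_of_eq ?_)
    rw [← Fintype.sum_prod_type', sum_measureReal_singleton, Finset.coe_univ, probReal_univ]

/-! ### The entropy of a partition along a random orbit -/

section Block

variable {X M ι : Type*} (f : X → M ≃ M)

/-- The word of labels read along the first `n` points of the orbit. -/
def word (c : M → ι) (n : ℕ) (p : (ℕ → X) × M) : Fin n → ι := fun i => c (fwd f p.1 i p.2)

/-- The letter at time `t` of a sequence of `q` words of length `N`. -/
noncomputable def letter [Nonempty ι] {q N : ℕ} (s : Fin q → Fin N → ι) (t : ℕ) : ι :=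
  if h : t / N < q ∧ 0 < N then s ⟨t / N, h.1⟩ ⟨t % N, Nat.mod_lt _ h.2⟩
  else Classical.arbitrary ι

variable {f}

theorem letter_word [Nonempty ι] {c : M → ι} {q N : ℕ} (p : (ℕ → X) × M) {t : ℕ}
    (ht : t < q * N) :
    letter (fun (l : Fin q) (r : Fin N) => c (fwd f p.1 (l * N + r) p.2)) t =
      c (fwd f p.1 t p.2) := by
  have hN : 0 < N := Nat.pos_of_ne_zero (by rintro rfl; simp at ht)
  have h : t / N < q ∧ 0 < N := ⟨(Nat.div_lt_iff_lt_mul hN).2 ht, hN⟩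
  rw [letter, dif_pos h]
  simp only [Nat.div_add_mod']

variable [MeasurableSpace X] [MeasurableSpace M]

theorem measurable_word [MeasurableSpace ι] (hf : Measurable fun p : X × M => f p.1 p.2)
    {c : M → ι} (hc : Measurable c) (n : ℕ) : Measurable (word f c n) :=
  measurable_pi_lambda _ fun i => hc.comp (measurable_fwd hf i)

theorem lintegral_neg_log_word {Y S : Type*} [MeasurableSpace Y] [Fintype S] [MeasurableSpace S]
    [DiscreteMeasurableSpace S] {ν : Measure Y} [IsProbabilityMeasure ν] {W : Y → S}
    (hW : Measurable W) :
    ∫⁻ p, ENNReal.ofReal (-Real.log (ν.real (W ⁻¹' {W p}))) ∂ν =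
      ENNReal.ofReal (∑ a, Real.negMulLog (ν.real (W ⁻¹' {a}))) := by
  have h := lintegral_map (μ := ν)
    (f := fun a : S => ENNReal.ofReal (-Real.log (ν.real (W ⁻¹' {a})))) (.of_discrete) hW
  rw [← h, lintegral_fintype, ENNReal.ofReal_sum_of_nonneg fun a _ =>
    Real.negMulLog_nonneg measureReal_nonneg measureReal_le_one]
  refine Finset.sum_congr rfl fun a _ => ?_
  rw [Measure.map_apply hW (measurableSet_singleton a), Real.negMulLog, neg_mul,
    ← mul_neg, ENNReal.ofReal_mul measureReal_nonneg, ofReal_measureReal, mul_comm]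

theorem ae_measureReal_preimage_pos {Y S : Type*} [MeasurableSpace Y] [Finite S]
    (ν : Measure Y) [IsFiniteMeasure ν] (W : Y → S) :
    ∀ᵐ p ∂ν, 0 < ν.real (W ⁻¹' {W p}) := by
  have h : ∀ a, ∀ᵐ p ∂ν, W p = a → 0 < ν.real (W ⁻¹' {a}) := by
    intro a
    by_cases h0 : ν (W ⁻¹' {a}) = 0
    · filter_upwards [measure_eq_zero_iff_ae_notMem.1 h0] with p hp hpa
      exact absurd hpa hp
    · exact .of_forall fun p _ => ENNReal.toReal_pos h0 (measure_ne_top _ _)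
  filter_upwards [ae_all_iff.2 h] with p hp
  exact hp _ rfl

theorem card_filter_window_le (L m : ℕ) :
    ((Finset.range L).filter fun i => ¬ (m ≤ i ∧ i + m < L)).card ≤ 2 * m := by
  have hsub : ((Finset.range L).filter fun i => ¬ (m ≤ i ∧ i + m < L)) ⊆
      Finset.range m ∪ Finset.Ico (L - m) L := by
    intro i hi
    simp only [Finset.mem_filter, Finset.mem_range, Finset.mem_union, Finset.mem_Ico] at hi ⊢
    omega
  refine (Finset.card_le_card hsub).trans ((Finset.card_union_le _ _).trans ?_)
  rw [Finset.card_range, Nat.card_Ico]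
  omega

/-- For fixed noise, the pair of `e`-word and `c`-word is coded by a subprobability: annealed block
probabilities for the `c`-word times a guess for each `e`-letter. Averaged over the noise, every
term is evaluated by invariance under the skew product. A correct guess costs `-log (1 - δ)`, a
wrong one `-log (δ / K)`, and each of the at most `2m` letters without a full window costs `log K`.
-/
theorem lintegral_entropy_le (hf : Measurable fun p : X × M => f p.1 p.2) {θ : Measure X}
    [IsProbabilityMeasure θ] {μ : Measure M} [IsProbabilityMeasure μ]
    (hst : (θ.prod μ).map (fun p => f p.1 p.2) = μ)
    [Fintype ι] [Nonempty ι] [MeasurableSpace ι] [DiscreteMeasurableSpace ι] {c : M → ι}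
    (hc : Measurable c)
    {κ : Type*} [Fintype κ] [Nonempty κ] [MeasurableSpace κ] [DiscreteMeasurableSpace κ]
    {e : M → κ} (he : Measurable e) {m : ℕ} {g : (ℕ → X) × (Fin (2 * m + 1) → ι) → κ}
    (hg : Measurable g) {δ : ℝ} (hδ0 : 0 < δ) (hδ1 : δ < 1) (q N : ℕ) :
    ∫⁻ w, ENNReal.ofReal (∑ a, Real.negMulLog
        (μ.real ((fun x => word f e (q * N) (w, x)) ⁻¹' {a}))) ∂(noise θ) ≤
      (q * N : ℕ) * (ENNReal.ofReal (-Real.log (1 - δ)) +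
        ENNReal.ofReal (-Real.log (δ / Fintype.card κ)) *
          ((noise θ).prod μ) {p | e (fwd f p.1 m p.2) ≠
            g (p.1, fun j => c (fwd f p.1 j p.2))}) +
      (2 * m : ℕ) * ENNReal.ofReal (Real.log (Fintype.card κ)) +
      q * ENNReal.ofReal (∑ a, Real.negMulLog
        (((noise θ).prod μ).real (word f c N ⁻¹' {a}))) := by
  classical
  set ν := (noise θ).prod μ with hν
  set L := q * N with hL
  set K : ℝ := (Fintype.card κ : ℝ) with hK
  have hKpos : 0 < K := by rw [hK]; exact_mod_cast Fintype.card_pos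
  set C₁ := ENNReal.ofReal (-Real.log (1 - δ)) with hC₁
  set C₂ := ENNReal.ofReal (-Real.log (δ / K)) with hC₂
  set C₃ := ENNReal.ofReal (Real.log K) with hC₃
  set Mis : Set ((ℕ → X) × M) := {p | e (fwd f p.1 m p.2) ≠
    g (p.1, fun j => c (fwd f p.1 j p.2))} with hMis
  have hMism : MeasurableSet Mis := by
    refine (measurableSet_eq_fun (he.comp (measurable_fwd hf m)) (hg.comp ?_)).compl
    exact measurable_fst.prodMk
      (measurable_pi_lambda _ fun j => hc.comp (measurable_fwd hf j))
  let F : ℕ → (ℕ → X) × M → (ℕ → X) × M := fun n p => (fun i => p.1 (i + n), fwd f p.1 n p.2)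
  have hF : ∀ n, MeasurePreserving (F n) ν ν := measurePreserving_skew_iterate hf hst
  let Q : (Fin N → ι) → ℝ := fun a => ν.real (word f c N ⁻¹' {a})
  have hQ0 : ∀ a, 0 ≤ Q a := fun a => measureReal_nonneg
  have hQ1 : ∑ a, Q a = 1 := by
    have : ∀ a, Q a = (ν.map (word f c N)).real {a} := fun a =>
      (map_measureReal_apply (measurable_word hf hc N) (measurableSet_singleton a)).symm
    simp only [this]
    have := Measure.isProbabilityMeasure_map (μ := ν) (measurable_word hf hc N).aemeasurable
    rw [sum_measureReal_singleton, Finset.coe_univ, probReal_univ]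
  -- the guesses
  let r : (ℕ → X) → ℕ → κ → (Fin q → Fin N → ι) → ℝ := fun w i b s =>
    if m ≤ i ∧ i + m < L then
      if b = g (fun n => w (n + (i - m)), fun j => letter s (i - m + j)) then 1 - δ else δ / K
    else 1 / K
  have hr0 : ∀ w i b s, 0 < r w i b s := by
    intro w i b s
    simp only [r]
    have : 0 < 1 - δ := by linarith
    split_ifs <;> positivity
  have hr1 : ∀ w i s, ∑ b, r w i b s ≤ 1 := by
    intro w i s
    simp only [r]
    split_ifs with h
    · set b₀ := g (fun n => w (n + (i - m)), fun j => letter s (i - m + j))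
      calc ∑ b, (if b = b₀ then 1 - δ else δ / K)
          ≤ ∑ b, ((if b = b₀ then 1 - δ else 0) + δ / K) := by
            refine Finset.sum_le_sum fun b _ => ?_
            have : 0 < δ / K := by positivity
            split_ifs <;> linarith
        _ = 1 := by
            rw [Finset.sum_add_distrib, Finset.sum_ite_eq' Finset.univ b₀, Finset.sum_const,
              Finset.card_univ, nsmul_eq_mul, ← hK]
            simp only [Finset.mem_univ, if_true]
            field_simp
            ring
    · rw [Finset.sum_const, Finset.card_univ, nsmul_eq_mul, ← hK]
      field_simp
      exact le_rfl
  let W : (ℕ → X) × M → Fin q → Fin N → ι := fun p l j => c (fwd f p.1 (l * N + j) p.2)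
  have hWF : ∀ p l, W p l = word f c N (F (l * N) p) := by
    intro p l
    funext j
    simp only [W, word, F, fwd_add]
  have hWm : Measurable W := measurable_pi_lambda _ fun l => measurable_pi_lambda _ fun j =>
    hc.comp (measurable_fwd hf _)
  let Φ : (ℕ → X) × M → ℝ≥0∞ := fun p =>
    (∑ i ∈ Finset.range L, if m ≤ i ∧ i + m < L then
      C₁ + Mis.indicator (fun _ => C₂) (F (i - m) p) else C₃) +
    ∑ l : Fin q, ENNReal.ofReal (-Real.log (Q (word f c N (F (l * N) p))))
  have hΦ₁m : ∀ i, Measurable fun p => if m ≤ i ∧ i + m < L then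
      C₁ + Mis.indicator (fun _ => C₂) (F (i - m) p) else C₃ := by
    intro i
    by_cases h : m ≤ i ∧ i + m < L
    · simp only [h, and_self, if_true]
      have hC : Measurable (Mis.indicator fun _ => C₂) := measurable_const.indicator hMism
      exact measurable_const.add (hC.comp (hF (i - m)).measurable)
    · simp only [h, if_false]
      exact measurable_const
  have hQm : Measurable fun p => ENNReal.ofReal (-Real.log (Q (word f c N p))) := by
    have : Measurable fun a => ENNReal.ofReal (-Real.log (Q a)) := .of_discrete
    exact this.comp (measurable_word hf hc N)
  have hΦ₂m : ∀ l : Fin q, Measurable fun p =>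
      ENNReal.ofReal (-Real.log (Q (word f c N (F (l * N) p)))) := fun l =>
    hQm.comp (hF _).measurable
  have hΦm : Measurable Φ :=
    (Finset.measurable_fun_sum _ fun i _ => hΦ₁m i).add
      (Finset.measurable_fun_sum _ fun l _ => hΦ₂m l)
  have hae : ∀ᵐ p ∂ν, ∀ l : Fin q, 0 < Q (W p l) := by
    refine ae_all_iff.2 fun l => ?_
    filter_upwards [(hF (l * N)).quasiMeasurePreserving.ae
      (ae_measureReal_preimage_pos ν (word f c N))] with p hp
    rw [hWF]
    exact hp
  have hstep : ∀ᵐ w ∂(noise θ), ENNReal.ofReal (∑ a, Real.negMulLog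
      (μ.real ((fun x => word f e L (w, x)) ⁻¹' {a}))) ≤ ∫⁻ x, Φ (w, x) ∂μ := by
    filter_upwards [Measure.ae_ae_of_ae_prod hae] with w hw
    have hYm : Measurable fun x => word f e L (w, x) :=
      (measurable_word hf he L).comp measurable_prodMk_left
    have hWw : Measurable fun x => W (w, x) := hWm.comp measurable_prodMk_left
    refine (ofReal_entropy_le_lintegral hYm hWw
      (q := fun y s => (∏ i : Fin L, r w i (y i) s) * ∏ l, Q (s l)) ?_ ?_ ?_).trans
      (lintegral_mono_ae ?_)
    · exact fun y s => mul_nonneg (Finset.prod_nonneg fun i _ => (hr0 _ _ _ _).le)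
        (Finset.prod_nonneg fun l _ => hQ0 _)
    -- Given the `c`-word, the guesses form a product of subprobabilities; what remains is a product
    -- of copies of `Q`.
    · rw [Finset.sum_comm]
      calc ∑ s : Fin q → Fin N → ι, ∑ y : Fin L → κ, (∏ i : Fin L, r w i (y i) s) * ∏ l, Q (s l)
          ≤ ∑ s : Fin q → Fin N → ι, ∏ l, Q (s l) := by
            refine Finset.sum_le_sum fun s _ => ?_
            rw [← Finset.sum_mul]
            refine mul_le_of_le_one_left (Finset.prod_nonneg fun l _ => hQ0 _) ?_
            have h := Finset.prod_univ_sum (fun _ : Fin L => (Finset.univ : Finset κ))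
              (fun i b => r w i b s)
            rw [Fintype.piFinset_univ] at h
            rw [← h]
            exact Finset.prod_le_one
              (fun i _ => Finset.sum_nonneg fun b _ => (hr0 _ _ _ _).le) fun i _ => hr1 _ _ _
        _ = 1 := by
            have h := Finset.prod_univ_sum (fun _ : Fin q => (Finset.univ : Finset (Fin N → ι)))
              (fun _ a => Q a)
            rw [Fintype.piFinset_univ] at h
            rw [← h]
            simp [hQ1]
    · filter_upwards [hw] with x hx
      exact mul_pos (Finset.prod_pos fun i _ => hr0 _ _ _ _) (Finset.prod_pos fun l _ => hx l)
    · filter_upwards [hw] with x hx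
      rw [Real.log_mul (Finset.prod_pos fun i _ => hr0 _ _ _ _).ne'
        (Finset.prod_pos fun l _ => hx l).ne', Real.log_prod fun i _ => (hr0 _ _ _ _).ne',
        Real.log_prod fun l _ => (hx l).ne', neg_add, ← Finset.sum_neg_distrib,
        ← Finset.sum_neg_distrib]
      refine ENNReal.ofReal_add_le.trans (add_le_add ?_ ?_)
      · refine (ofReal_sum_le _ _).trans ?_
        refine (Fin.sum_univ_eq_sum_range (fun i => ENNReal.ofReal
          (-Real.log (r w i (e (fwd f w i x)) (W (w, x))))) L).trans_le ?_
        refine Finset.sum_le_sum fun i hi => ?_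
        have hi' := Finset.mem_range.1 hi
        by_cases h : m ≤ i ∧ i + m < L
        · have hlet : (fun j : Fin (2 * m + 1) => letter (W (w, x)) (i - m + j)) =
              fun j : Fin (2 * m + 1) => c (fwd f (F (i - m) (w, x)).1 j (F (i - m) (w, x)).2) := by
            funext j
            have hj := j.2
            rw [letter_word (f := f) (c := c) (w, x) (by omega)]
            simp only [F, fwd_add]
          have hei : fwd f w i x = fwd f (F (i - m) (w, x)).1 m (F (i - m) (w, x)).2 := by
            simp only [F, ← fwd_add, Nat.sub_add_cancel h.1]
          simp only [r, h, and_self, if_true, hlet, hei]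
          by_cases hmis : F (i - m) (w, x) ∈ Mis
          · rw [indicator_of_mem hmis, if_neg hmis]
            exact le_add_self
          · rw [indicator_of_notMem hmis, add_zero, if_pos (not_not.1 hmis)]
        · simp only [r, h, if_false]
          rw [one_div, Real.log_inv, neg_neg]
      · refine (ofReal_sum_le _ _).trans (Finset.sum_le_sum fun l _ => ?_)
        rw [hWF]
  refine (lintegral_mono_ae hstep).trans ?_
  rw [← lintegral_prod _ hΦm.aemeasurable]
  simp only [Φ]
  rw [lintegral_add_right _ (Finset.measurable_fun_sum _ fun l _ => hΦ₂m l),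
    lintegral_finsetSum _ fun i _ => hΦ₁m i, lintegral_finsetSum _ fun l _ => hΦ₂m l]
  refine add_le_add ?_ ?_
  · have hterm : ∀ i, ∫⁻ p, (if m ≤ i ∧ i + m < L then
        C₁ + Mis.indicator (fun _ => C₂) (F (i - m) p) else C₃) ∂ν ≤
        (C₁ + C₂ * ν Mis) + if ¬ (m ≤ i ∧ i + m < L) then C₃ else 0 := by
      intro i
      by_cases h : m ≤ i ∧ i + m < L
      · simp only [h, and_self, if_true, not_true_eq_false, if_false, add_zero]
        rw [lintegral_add_left measurable_const, lintegral_const, measure_univ, mul_one,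
          (hF (i - m)).lintegral_comp (measurable_const.indicator hMism),
          lintegral_indicator_const hMism]
      · simp only [h, if_false, not_false_eq_true, if_true]
        rw [lintegral_const, measure_univ, mul_one]
        exact le_add_self
    refine (Finset.sum_le_sum fun i _ => hterm i).trans ?_
    rw [Finset.sum_add_distrib, Finset.sum_const, Finset.card_range, nsmul_eq_mul,
      ← Finset.sum_filter, Finset.sum_const, nsmul_eq_mul]
    gcongr
    exact card_filter_window_le L m
  · refine (Finset.sum_le_sum (g := fun _ => ENNReal.ofReal (∑ a, Real.negMulLog (Q a)))
      fun l _ => ?_).trans_eq ?_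
    · rw [(hF (l * N)).lintegral_comp hQm]
      exact (lintegral_neg_log_word (measurable_word hf hc N)).le
    · rw [Finset.sum_const, Finset.card_univ, Fintype.card_fin, nsmul_eq_mul]

end Block

/-! ### Random generating partitions compute the entropy -/

theorem IsPartition.exists_label {M : Type*} [MeasurableSpace M] [Nonempty M] {k : ℕ}
    {η : Fin k → Set M} (hη : IsPartition η) :
    Nonempty (Fin k) ∧ ∃ e : M → Fin k, Measurable e ∧ ∀ x i, e x = i ↔ x ∈ η i := by
  have hex : ∀ x, ∃ i, x ∈ η i := fun x => by
    have : x ∈ ⋃ i, η i := hη.iUnion_eq ▸ mem_univ x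
    simpa using this
  have hne : Nonempty (Fin k) := ⟨(hex (Classical.arbitrary M)).choose⟩
  obtain ⟨e, he, hmem⟩ := exists_measurable_index hη.measurableSet
  refine ⟨hne, e, he, fun x i => ⟨fun h => h ▸ hmem x (hex x), fun h => ?_⟩⟩
  by_contra hi
  exact disjoint_left.1 (hη.disjoint _ _ hi) (hmem x (hex x)) h

/-- The infimum is tested at lengths `(q + 1) * N`; after division, the end cost `b` vanishes as `q
→ ∞`. -/
theorem randomEntropyWrt_le_of_guess {X M : Type*} [MeasurableSpace X]
    [MeasurableSpace M] {f : X → M ≃ M} {θ : Measure X} [IsProbabilityMeasure θ] {μ : Measure M}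
    {k : ℕ} {η : Fin k → Set M} {e : M → Fin k} (hη : ∀ x i, e x = i ↔ x ∈ η i) {a b H : ℝ≥0∞}
    (hb : b ≠ ⊤) {N : ℕ} (hN : N ≠ 0)
    (h : ∀ q : ℕ, ∫⁻ w, ENNReal.ofReal (∑ a, Real.negMulLog
        (μ.real ((fun x => word f e (q * N) (w, x)) ⁻¹' {a}))) ∂(noise θ) ≤
      (q * N : ℕ) * a + b + q * H) :
    randomEntropyWrt f θ μ η ≤ a + H / N := by
  have hq : ∀ q : ℕ, randomEntropyWrt f θ μ η ≤ a + b / (q + 1 : ℕ) + H / N := by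
    intro q
    have hL : 0 < (q + 1) * N := Nat.mul_pos q.succ_pos (Nat.pos_of_ne_zero hN)
    have hset : ∀ w, partitionEntropy μ (randomJoin f w η ((q + 1) * N)) =
        ∑ a, Real.negMulLog (μ.real ((fun x => word f e ((q + 1) * N) (w, x)) ⁻¹' {a})) := by
      intro w
      refine Finset.sum_congr rfl fun a _ => ?_
      congr 2
      ext x
      simp only [randomJoin, mem_ofPred_eq, mem_preimage, mem_singleton_iff, word, funext_iff, hη]
    refine (iInf_le _ (⟨(q + 1) * N, hL⟩ : ℕ+)).trans ?_
    change (∫⁻ w, ENNReal.ofReal (partitionEntropy μ (randomJoin f w η ((q + 1) * N))) ∂noise θ) /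
      (((q + 1) * N : ℕ) : ℝ≥0∞) ≤ _
    simp only [hset]
    refine (ENNReal.div_le_div_right (h (q + 1)) _).trans ?_
    have hL0 : (((q + 1) * N : ℕ) : ℝ≥0∞) ≠ 0 := by exact_mod_cast hL.ne'
    rw [ENNReal.add_div, ENNReal.add_div]
    refine add_le_add (add_le_add ?_ ?_) ?_
    · rw [mul_div_assoc, mul_comm, ENNReal.div_mul_cancel hL0 (ENNReal.natCast_ne_top _)]
    · refine ENNReal.div_le_div_left ?_ _
      exact_mod_cast Nat.le_mul_of_pos_right _ (Nat.pos_of_ne_zero hN)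
    · rw [Nat.cast_mul, ENNReal.mul_div_mul_left _ _ (by exact_mod_cast q.succ_ne_zero)
        (ENNReal.natCast_ne_top _)]
  have hlim : Tendsto (fun q : ℕ => a + b / (q + 1 : ℕ) + H / N) atTop (𝓝 (a + 0 + H / N)) := by
    refine (Tendsto.add tendsto_const_nhds ?_).add tendsto_const_nhds
    have h1 : Tendsto (fun q : ℕ => b / (q : ℝ≥0∞)) atTop (𝓝 (b / ⊤)) :=
      ENNReal.Tendsto.div tendsto_const_nhds (Or.inr ENNReal.top_ne_zero)
        ENNReal.tendsto_nat_nhds_top (Or.inr hb)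
    rw [ENNReal.div_top] at h1
    exact h1.comp (tendsto_add_atTop_nat 1)
  rw [add_zero] at hlim
  exact ge_of_tendsto' hlim hq

section Generator

variable {X M : Type*} [MetricSpace X] [CompactSpace X] [MeasurableSpace X] [BorelSpace X]
  [MetricSpace M] [SigmaCompactSpace M] [SecondCountableTopology M] [MeasurableSpace M]
  [BorelSpace M] [LocallyCompactSpace M] {f : X → M ≃ M}

theorem randomEntropy_le_of_generating (hf : Continuous fun p : X × M => f p.1 p.2)
    {θ : Measure X} [IsProbabilityMeasure θ] {μ : Measure M} [IsProbabilityMeasure μ]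
    (hst : (θ.prod μ).map (fun p => f p.1 p.2) = μ)
    {ι : Type*} [Fintype ι] [Nonempty ι] [MeasurableSpace ι] [DiscreteMeasurableSpace ι]
    {c : M → ι} (hc : Measurable c) {k : ℕ} {ξ : Fin k → Set M} {N₀ Z : Set M}
    (hNμ : μ N₀ = 0) (hZμ : μ Z = 0)
    (hcξ : ∀ x ∉ Z, ∀ y ∉ Z, c x = c y → ∀ i, x ∈ ξ i ↔ y ∈ ξ i)
    (hgen : ∀ᵐ w ∂(Measure.infinitePi fun _ : ℤ => θ), ∀ A : Set M, MeasurableSet A →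
      ∃ B : Set M, MeasurableSet[orbitSigma f w ξ] B ∧ A \ N₀ = B \ N₀)
    {N : ℕ} (hN : N ≠ 0) :
    randomEntropy f θ μ ≤
      ENNReal.ofReal (∑ a, Real.negMulLog (((noise θ).prod μ).real (word f c N ⁻¹' {a}))) / N := by
  refine iSup_le fun K => iSup_le fun η => iSup_le fun hη => ?_
  have hM : Nonempty M := nonempty_of_isProbabilityMeasure μ
  obtain ⟨hK, e, he, hemem⟩ := hη.exists_label
  set H := ENNReal.ofReal
    (∑ a, Real.negMulLog (((noise θ).prod μ).real (word f c N ⁻¹' {a}))) with hH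
  have hδ : ∀ δ : ℝ, 0 < δ → δ < 1 → randomEntropyWrt f θ μ η ≤
      (ENNReal.ofReal (-Real.log (1 - δ)) + ENNReal.ofReal δ) + H / N := by
    intro δ hδ0 hδ1
    set C := ENNReal.ofReal (-Real.log (δ / Fintype.card (Fin K))) with hC
    -- The error probability is chosen after the cost `C` of a wrong guess, so that errors cost at
    -- most `δ` per letter.
    obtain ⟨m, g, hg, hmis⟩ := exists_guess hf hst hc he hNμ hZμ hcξ hgen
      (δ := ENNReal.ofReal δ / C)
      (ENNReal.div_pos (ENNReal.ofReal_pos.2 hδ0).ne' ENNReal.ofReal_ne_top)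
    refine (randomEntropyWrt_le_of_guess hemem (b := (2 * m : ℕ) *
      ENNReal.ofReal (Real.log (Fintype.card (Fin K)))) (H := H)
      (ENNReal.mul_ne_top (ENNReal.natCast_ne_top _) ENNReal.ofReal_ne_top) hN
      fun q => lintegral_entropy_le hf.measurable hst hc he hg hδ0 hδ1 q N).trans ?_
    gcongr
    exact (mul_le_mul_right hmis _).trans ENNReal.mul_div_le
  have hlim : Tendsto (fun δ : ℝ => (ENNReal.ofReal (-Real.log (1 - δ)) + ENNReal.ofReal δ) +
      H / N) (𝓝[>] 0) (𝓝 ((ENNReal.ofReal (-Real.log (1 - 0)) + ENNReal.ofReal 0) + H / N)) := by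
    refine Tendsto.mono_left ?_ nhdsWithin_le_nhds
    have h1 : ContinuousAt (fun δ : ℝ => -Real.log (1 - δ)) 0 :=
      ((continuousAt_const.sub continuousAt_id).log (by simp)).neg
    exact ((ENNReal.tendsto_ofReal h1.tendsto).add (ENNReal.tendsto_ofReal tendsto_id)).add
      tendsto_const_nhds
  simp only [sub_zero, Real.log_one, neg_zero, ENNReal.ofReal_zero, zero_add] at hlim
  refine ge_of_tendsto hlim ?_
  filter_upwards [Ioo_mem_nhdsGT (zero_lt_one' ℝ)] with δ h
  exact hδ δ h.1 h.2

end Generator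

/-! ### Stationary measures -/

section Stationary

variable {X M : Type*} [MetricSpace X] [CompactSpace X] [MeasurableSpace X] [BorelSpace X]
  [MetricSpace M] [SecondCountableTopology M] [MeasurableSpace M] [BorelSpace M] {f : X → M ≃ M}

theorem IsStationary.map_prod_eq (hf : Continuous fun p : X × M => f p.1 p.2) {θ : Measure X}
    [IsProbabilityMeasure θ] {μ : Measure M} [IsProbabilityMeasure μ] (h : IsStationary f θ μ) :
    (θ.prod μ).map (fun p => f p.1 p.2) = μ := by
  have := Measure.isProbabilityMeasure_map (μ := θ.prod μ) hf.measurable.aemeasurable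
  refine ext_of_forall_integral_eq_of_IsFiniteMeasure fun φ => ?_
  rw [integral_map hf.measurable.aemeasurable φ.continuous.aestronglyMeasurable, ← h φ]
  exact integral_prod _ ((φ.compContinuous ⟨_, hf⟩).integrable _)

/-- By stationarity `μ` is the average of the laws of `t ↦ f_t(x)`, which are absolutely continuous
for `μ`-almost every `x`. -/
theorem measure_eq_zero_of_isLebesgueNull {d : ℕ} [ChartedSpace (EuclideanSpace ℝ (Fin d)) M]
    (hf : Continuous fun p : X × M => f p.1 p.2) {θ : Measure X}
    [IsProbabilityMeasure θ] {μ : Measure M} [IsProbabilityMeasure μ]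
    (hst : (θ.prod μ).map (fun p => f p.1 p.2) = μ) {U : Set M} (hU : μ Uᶜ = 0)
    (hac : ∀ x ∈ U, LebesgueAC d (θ.map fun t => f t x)) {A : Set M} (hA : MeasurableSet A)
    (hA0 : IsLebesgueNull d A) : μ A = 0 := by
  rw [← hst, Measure.map_apply hf.measurable hA,
    Measure.prod_apply_symm (hf.measurable hA), lintegral_eq_zero_iff
      (measurable_measure_prodMk_right (hf.measurable hA))]
  have hU' : ∀ᵐ x ∂μ, x ∈ U := hU
  filter_upwards [hU'] with x hx
  have hm : Measurable fun t => f t x := hf.measurable.comp measurable_prodMk_right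
  have := hac x hx A hA hA0
  rwa [Measure.map_apply hm hA] at this

end Stationary

/-! ### The zero noise limit -/

theorem frontier_iInter_subset {Y ι : Type*} [TopologicalSpace Y] [Finite ι] (s : ι → Set Y) :
    frontier (⋂ i, s i) ⊆ ⋃ i, frontier (s i) := by
  intro x hx
  rw [frontier_eq_closure_inter_closure, compl_iInter, closure_iUnion_of_finite] at hx
  obtain ⟨i, hi⟩ := mem_iUnion.1 hx.2
  refine mem_iUnion.2 ⟨i, ?_⟩
  rw [frontier_eq_closure_inter_closure]
  exact ⟨closure_mono (iInter_subset s i) hx.1, hi⟩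

theorem tendsto_dirac_of_eventually_ae_mem {Y : Type*} [TopologicalSpace Y] [MeasurableSpace Y]
    [OpensMeasurableSpace Y] {μ : ℕ → ProbabilityMeasure Y} {y : Y}
    {δ : ProbabilityMeasure Y} (hδ : (δ : Measure Y) = Measure.dirac y)
    (h : ∀ V ∈ 𝓝 y, ∀ᶠ j in atTop, ∀ᵐ x ∂(μ j : Measure Y), x ∈ V) :
    Tendsto μ atTop (𝓝 δ) := by
  rw [ProbabilityMeasure.tendsto_iff_forall_integral_tendsto]
  intro φ
  rw [hδ, integral_dirac' _ _ φ.continuous.stronglyMeasurable, Metric.tendsto_nhds]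
  intro r hr
  have hV : φ ⁻¹' Metric.closedBall (φ y) (r / 2) ∈ 𝓝 y :=
    φ.continuous.continuousAt (Metric.closedBall_mem_nhds _ (half_pos hr))
  filter_upwards [h _ hV] with j hj
  have e : ∫ x, φ x ∂(μ j : Measure Y) - φ y = ∫ x, (φ x - φ y) ∂(μ j : Measure Y) := by
    rw [integral_sub (φ.integrable _) (integrable_const _)]
    simp
  rw [dist_eq_norm, e]
  have := norm_integral_le_of_norm_le_const (μ := (μ j : Measure Y)) (f := fun x => φ x - φ y)
    (C := r / 2) (hj.mono fun x hx => by rw [← dist_eq_norm]; exact hx)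
  rw [probReal_univ, mul_one] at this
  linarith

section Limit

variable {X M : Type*} [MetricSpace X] [CompactSpace X] [MeasurableSpace X] [BorelSpace X]
  [MetricSpace M] [SecondCountableTopology M] [MeasurableSpace M] [BorelSpace M] {f : X → M ≃ M}

/-- The noise `θ^ℕ`, as a probability measure. -/
noncomputable def noiseProb (θ : ProbabilityMeasure X) : ProbabilityMeasure (ℕ → X) :=
  ⟨noise (θ : Measure X), inferInstance⟩

/-- The point mass at `t`, as a probability measure. -/
noncomputable def diracProb (t : X) : ProbabilityMeasure X := ⟨Measure.dirac t, inferInstance⟩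

/-- A basic neighbourhood of the constant sequence constrains finitely many coordinates, so the
noise eventually lies in it almost surely. -/
theorem tendsto_noiseProb {θ : ℕ → ProbabilityMeasure X} {t₀ : X}
    (h : ∀ V ∈ 𝓝 t₀, ∀ᶠ j in atTop, ∀ᵐ t ∂(θ j : Measure X), t ∈ V) :
    Tendsto (fun j => noiseProb (θ j)) atTop (𝓝 (noiseProb (diracProb t₀))) := by
  refine tendsto_dirac_of_eventually_ae_mem (y := fun _ => t₀)
    (Measure.infinitePi_dirac fun _ : ℕ => t₀) fun V hV => ?_
  rw [nhds_pi, Filter.mem_pi'] at hV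
  obtain ⟨I, u, hu, hIV⟩ := hV
  have hall : ∀ᶠ j in atTop, ∀ i ∈ I, ∀ᵐ t ∂(θ j : Measure X), t ∈ u i :=
    (Finset.eventually_all I).2 fun i _ => h _ (hu i)
  filter_upwards [hall] with j hj
  have : ∀ᵐ w ∂(noise (θ j : Measure X)), ∀ i ∈ I, w i ∈ u i := by
    refine (Finset.eventually_all I).2 fun i hi => ?_
    exact (measurePreserving_eval_infinitePi (fun _ : ℕ => (θ j : Measure X)) i)
      |>.quasiMeasurePreserving.ae (hj i hi)
  exact this.mono fun w hw => hIV fun i hi => hw i hi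

/-- Stationarity passes to the weak limit by joint continuity, and for the point mass at `t₀` it is
invariance of `μ₀` under `f t₀`. -/
theorem map_prod_dirac_eq_of_tendsto (hf : Continuous fun p : X × M => f p.1 p.2)
    {θ : ℕ → ProbabilityMeasure X} {t₀ : X}
    (h : ∀ V ∈ 𝓝 t₀, ∀ᶠ j in atTop, ∀ᵐ t ∂(θ j : Measure X), t ∈ V)
    {μ : ℕ → ProbabilityMeasure M} {μ₀ : ProbabilityMeasure M} (hμ : Tendsto μ atTop (𝓝 μ₀))
    (hst : ∀ j, ((θ j : Measure X).prod (μ j : Measure M)).map (fun p => f p.1 p.2) = μ j) :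
    ((Measure.dirac t₀).prod (μ₀ : Measure M)).map (fun p => f p.1 p.2) = μ₀ := by
  have hθ : Tendsto θ atTop (𝓝 (diracProb t₀)) := tendsto_dirac_of_eventually_ae_mem rfl h
  have h1 := (ProbabilityMeasure.continuous_prod.tendsto (diracProb t₀, μ₀)).comp
    (hθ.prodMk_nhds hμ)
  have h2 := ProbabilityMeasure.tendsto_map_of_tendsto_of_continuous _ _ h1 hf
  have h3 : ∀ j, ((θ j).prod (μ j)).map hf.measurable.aemeasurable = μ j := fun j =>
    Subtype.ext (hst j)
  have h4 := tendsto_nhds_unique (h2.congr h3) hμ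
  exact congrArg (fun ν : ProbabilityMeasure M => (ν : Measure M)) h4

/-- The points whose itinerary up to time `n` is `a`. -/
def itinerary {k : ℕ} (f : X → M ≃ M) (ξ : Fin k → Set M) (n : ℕ) (a : Fin n → Fin k) :
    Set ((ℕ → X) × M) :=
  {p | ∀ i : Fin n, fwd f p.1 i p.2 ∈ ξ (a i)}

theorem tendsto_itinerary (hf : Continuous fun p : X × M => f p.1 p.2)
    {θ : ℕ → ProbabilityMeasure X} {t₀ : X}
    (h : ∀ V ∈ 𝓝 t₀, ∀ᶠ j in atTop, ∀ᵐ t ∂(θ j : Measure X), t ∈ V)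
    {μ : ℕ → ProbabilityMeasure M} {μ₀ : ProbabilityMeasure M} (hμ : Tendsto μ atTop (𝓝 μ₀))
    (hst : ∀ j, ((θ j : Measure X).prod (μ j : Measure M)).map (fun p => f p.1 p.2) = μ j)
    {k : ℕ} {ξ : Fin k → Set M} (hξ : ∀ i, MeasurableSet (ξ i))
    (hbd : ∀ i, (μ₀ : Measure M) (frontier (ξ i)) = 0) (n : ℕ) (a : Fin n → Fin k) :
    Tendsto (fun j => ((noise (θ j : Measure X)).prod (μ j : Measure M)).real (itinerary f ξ n a))
      atTop (𝓝 ((μ₀ : Measure M).real (iterJoin (f t₀) ξ n a))) := by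
  have hinv := map_prod_dirac_eq_of_tendsto hf h hμ hst
  have hE : itinerary f ξ n a = ⋂ i : Fin n, (fun p : (ℕ → X) × M => fwd f p.1 i p.2) ⁻¹' ξ (a i) := by
    ext p
    simp [itinerary]
  have hEm : MeasurableSet (itinerary f ξ n a) := by
    rw [hE]
    exact .iInter fun i => (measurable_fwd hf.measurable i) (hξ _)
  have h1 := (ProbabilityMeasure.continuous_prod.tendsto (noiseProb (diracProb t₀), μ₀)).comp
    ((tendsto_noiseProb h).prodMk_nhds hμ)
  -- The boundary of the cylinder lies over preimages of the boundaries of the atoms; invariance of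
  -- the limit measure reduces these to time `0`.
  have hnull : ((noise (Measure.dirac t₀)).prod (μ₀ : Measure M))
      (frontier (itinerary f ξ n a)) = 0 := by
    rw [hE]
    refine measure_mono_null (frontier_iInter_subset _) (measure_iUnion_null fun i => ?_)
    refine measure_mono_null ((continuous_fwd hf i).frontier_preimage_subset _) ?_
    have hi := (measurePreserving_skew_iterate hf.measurable hinv i).quasiMeasurePreserving
    exact (Measure.quasiMeasurePreserving_snd.comp hi).preimage_null (hbd (a i))
  have h2 := ProbabilityMeasure.tendsto_measure_of_null_frontier_of_tendsto' h1 hnull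
  have h3 := (ENNReal.tendsto_toReal (measure_ne_top _ _)).comp h2
  have hlim : ((noise (Measure.dirac t₀)).prod (μ₀ : Measure M)) (itinerary f ξ n a) =
      (μ₀ : Measure M) (iterJoin (f t₀) ξ n a) := by
    rw [noise, Measure.infinitePi_dirac, Measure.dirac_prod,
      Measure.map_apply measurable_prodMk_left hEm]
    congr 1
    ext x
    simp [itinerary, iterJoin, fwd_const]
  rw [measureReal_def, ← hlim]
  exact h3

end Limit

/-! ### Partitions modulo zero -/

/-- A partition modulo zero is replaced by an honest labelling, arbitrary where atoms overlap or
fail to cover. -/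
theorem exists_label_of_ae_partition {M : Type*} [MeasurableSpace M] {k : ℕ} [Nonempty (Fin k)]
    {ξ : Fin k → Set M} (hξ : ∀ i, MeasurableSet (ξ i)) :
    ∃ c : M → Fin k, Measurable c ∧
      ∀ x ∉ (⋃ i, ξ i)ᶜ ∪ ⋃ (i) (j) (_ : i ≠ j), ξ i ∩ ξ j, ∀ i, c x = i ↔ x ∈ ξ i := by
  obtain ⟨c, hc, hmem⟩ := exists_measurable_index hξ
  refine ⟨c, hc, fun x hx i => ?_⟩
  simp only [mem_union, mem_compl_iff, mem_iUnion, not_or, not_exists] at hx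
  obtain ⟨hx1, hx2⟩ := hx
  have hcx := hmem x (not_forall_not.1 fun h => hx1 h)
  refine ⟨fun h => h ▸ hcx, fun h => ?_⟩
  by_contra hne
  exact hx2 _ _ hne ⟨hcx, h⟩

end RandomDyn
-- The semicontinuity theorem
theorem mainTheorem5 {d : ℕ} {X M : Type*}
    [MetricSpace X] [CompactSpace X] [ConnectedSpace X] [MeasurableSpace X] [BorelSpace X]
    [MetricSpace M] [SecondCountableTopology M] [ChartedSpace (EuclideanSpace ℝ (Fin d)) M]
    [IsManifold (𝓡 d) ∞ M] [MeasurableSpace M] [BorelSpace M]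
    (f : X → M ≃ₘ^1⟮𝓡 d, 𝓡 d⟯ M) (hf : Continuous fun p : X × M => f p.1 p.2)
    (θ : ℝ → ProbabilityMeasure X) (t₀ : X) (U : Set M) (hU : IsOpen U)
    (hND : RandomDyn.IsNondegenerate d (fun t => (f t).toEquiv)
      (fun ε => (θ ε : Measure X)) t₀ U)
    {k : ℕ} (ξ : Fin k → Set M) (hξ : RandomDyn.IsLebesguePartition d ξ)
    (hgen : ∀ᶠ ε in 𝓝[>] (0 : ℝ),
      RandomDyn.IsRandomGenerating d (fun t => (f t).toEquiv) (θ ε : Measure X) ξ)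
    (ε : ℕ → ℝ) (hεpos : ∀ j, 0 < ε j) (hε : Tendsto ε atTop (𝓝 0))
    (μ : ℕ → ProbabilityMeasure M)
    (hstat : ∀ j, RandomDyn.IsStationary (fun t => (f t).toEquiv) (θ (ε j) : Measure X)
      (μ j : Measure M))
    (hμU : ∀ j, (μ j : Measure M) Uᶜ = 0)
    (μ₀ : ProbabilityMeasure M) (hμ : Tendsto μ atTop (𝓝 μ₀))
    (hbd : ∀ i, (μ₀ : Measure M) (frontier (ξ i)) = 0) :
    limsup (fun j => RandomDyn.randomEntropy (fun t => (f t).toEquiv) (θ (ε j) : Measure X)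
      (μ j : Measure M)) atTop ≤
      RandomDyn.mapEntropy (f t₀) (μ₀ : Measure M) ξ := by
  have : LocallyCompactSpace M :=
    ChartedSpace.locallyCompactSpace (EuclideanSpace ℝ (Fin d)) M
  set F : X → M ≃ M := fun t => (f t).toEquiv with hF
  have hFc : Continuous fun p : X × M => F p.1 p.2 := hf
  have hε' : Tendsto ε atTop (𝓝[>] 0) :=
    tendsto_nhdsWithin_iff.2 ⟨hε, .of_forall hεpos⟩
  have hst : ∀ j, ((θ (ε j) : Measure X).prod (μ j : Measure M)).map (fun p => F p.1 p.2) = μ j :=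
    fun j => (hstat j).map_prod_eq hFc
  have hsupp : ∀ V ∈ 𝓝 t₀, ∀ᶠ j in atTop, ∀ᵐ t ∂(θ (ε j) : Measure X), t ∈ V := by
    intro V hV
    filter_upwards [hε'.eventually (hND.support_tendsto V hV)] with j hj
    exact mem_of_superset (Measure.support_mem_ae_of_regular) hj
  set Z : Set M := (⋃ i, ξ i)ᶜ ∪ ⋃ (i) (j) (_ : i ≠ j), ξ i ∩ ξ j with hZ
  -- With `N` fixed, only finitely many cylinders have to converge.
  refine le_iInf fun N => ?_
  have hlim : Tendsto (fun j => ENNReal.ofReal (∑ a, Real.negMulLog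
      (((RandomDyn.noise (θ (ε j) : Measure X)).prod (μ j : Measure M)).real
        (RandomDyn.itinerary F ξ N a))) / ((N : ℕ) : ℝ≥0∞)) atTop
      (𝓝 (ENNReal.ofReal (RandomDyn.partitionEntropy (μ₀ : Measure M)
        (RandomDyn.iterJoin (f t₀) ξ N)) / ((N : ℕ) : ℝ≥0∞))) := by
    refine ENNReal.Tendsto.div_const (ENNReal.tendsto_ofReal (tendsto_finsetSum _ fun a _ => ?_))
      (Or.inr (by exact_mod_cast N.ne_zero))
    exact (Real.continuous_negMulLog.tendsto _).comp
      (RandomDyn.tendsto_itinerary hFc hsupp hμ hst hξ.measurableSet hbd N a)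
  refine (limsup_le_limsup ?_).trans_eq hlim.limsup_eq
  filter_upwards [hε'.eventually hND.nondegenerate, hε'.eventually hgen] with j hnd hg
  obtain ⟨δ, -, hδ⟩ := hnd
  obtain ⟨N₀, hN₀m, hN₀, hgen'⟩ := hg
  have hac : ∀ {A : Set M}, MeasurableSet A → RandomDyn.IsLebesgueNull d A →
      (μ j : Measure M) A = 0 := fun hA hA0 =>
    RandomDyn.measure_eq_zero_of_isLebesgueNull hFc (hst j) (hμU j)
      (fun x hx => (hδ x hx).2) hA hA0
  have hcompl : (μ j : Measure M) (⋃ i, ξ i)ᶜ = 0 :=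
    hac (MeasurableSet.iUnion hξ.measurableSet).compl hξ.null_compl
  have hZμ : (μ j : Measure M) Z = 0 := by
    refine measure_union_null hcompl (measure_iUnion_null fun i => measure_iUnion_null fun i' =>
      measure_iUnion_null fun hne => ?_)
    exact hac ((hξ.measurableSet i).inter (hξ.measurableSet i')) (hξ.null_inter i i' hne)
  -- An empty family would make all of `M` Lebesgue-null, hence null for the probability measure `μ
  -- j`.
  have hk : Nonempty (Fin k) := by
    by_contra hne
    rw [not_nonempty_iff] at hne
    rw [iUnion_of_empty, compl_empty, measure_univ] at hcompl
    exact one_ne_zero hcompl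
  obtain ⟨c, hc, hcξ⟩ := RandomDyn.exists_label_of_ae_partition hξ.measurableSet
  refine (RandomDyn.randomEntropy_le_of_generating hFc (hst j) hc (hac hN₀m hN₀) hZμ
    (fun x hx y hy hxy i => by rw [← hcξ x hx, ← hcξ y hy, hxy]) hgen' N.ne_zero).trans_eq ?_
  -- Almost every orbit avoids `Z` at all times, so reading the labels `c` or the atoms of `ξ` gives
  -- the same itinerary.
  have hword : ∀ a, ((RandomDyn.noise (θ (ε j) : Measure X)).prod (μ j : Measure M)).real
      (RandomDyn.word F c N ⁻¹' {a}) = ((RandomDyn.noise (θ (ε j) : Measure X)).prod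
        (μ j : Measure M)).real (RandomDyn.itinerary F ξ N a) := by
    intro a
    refine measureReal_congr ?_
    have hae : ∀ᵐ p ∂(RandomDyn.noise (θ (ε j) : Measure X)).prod (μ j : Measure M),
        ∀ i : ℕ, RandomDyn.fwd F p.1 i p.2 ∉ Z := ae_all_iff.2 fun i =>
      (RandomDyn.measurePreserving_skew_iterate hFc.measurable (hst j) i).quasiMeasurePreserving.ae
        (Measure.quasiMeasurePreserving_snd.ae (measure_eq_zero_iff_ae_notMem.1 hZμ))
    filter_upwards [hae] with p hp
    refine propext ?_
    change RandomDyn.word F c N p = a ↔ ∀ i : Fin N, RandomDyn.fwd F p.1 i p.2 ∈ ξ (a i)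
    rw [funext_iff]
    exact forall_congr' fun i => hcξ _ (hp i) _
  simp only [hword]
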